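/- Let $d\ge 2$ and let $\mu$ be a Borel probability measure on $SL(d,\mathbb R)$ with $\int\log\|A\|\,d\mu(A)<+\infty$, where $\|\cdot\|$ is the Euclidean operator norm. For a sequence $x=(x_n)_{n\ge0}$ of matrices put $Z_n=x_{n-1}\cdots x_0$. Let $\gamma^-\le 0\le\gamma^+$ be the extremal Lyapunov exponents of $\mu$, that is, the numbers (which exist) such that for $\mu^{\otimes\mathbb N}$-a.e. $x$, $$\gamma^+=\lim_{n\to\infty}\tfrac1n\log\|Z_n\|,\qquad \gamma^-=-\lim_{n\to\infty}\tfrac1n\log\|Z_n^{-1}\|.$$ For $d=2$ one has $\gamma^-=-\gamma^+$, and one writes $\gamma=\gamma^+$. Let the group act naturally on the projective space $\mathbb P^{d-1}$ of lines of $\mathbb R^d$. A Borel probability measure $\nu$ on $\mathbb P^{d-1}$ is stationary if $\nu=\int A_*\nu\,d\mu(A)$, and its Furstenberg entropy is $$\kappa(\mu,\nu)=\int\!\!\int\log\frac{dA_*\nu}{d\nu}(A\xi)\,d\nu(\xi)\,d\mu(A)\in[0,+\infty],$$ with the value $+\infty$ if $A_*\nu$ is not absolutely continuous with respect to $\nu$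 for a set of $A$ of positive $\mu$-measure, or if the integrand is not integrable. (1) Case $d=2$. Every stationary probability measure $\nu$ on $\mathbb P^1$ satisfies $\kappa(\mu,\nu)\le 2\gamma$. If $\gamma=0$, then there is a probability measure $\nu$ on $\mathbb P^1$ with $A_*\nu=\nu$ for $\mu$-a.e. $A$. (2) Case of any $d\ge2$. Every stationary probability measure $\nu$ on $\mathbb P^{d-1}$ satisfies $\kappa(\mu,\nu)\le (d-1)(\gamma^+-\gamma^-)$. If $\gamma^+=0$, then there is a probability measure $\nu$ on $\mathbb P^{d-1}$ with $A_*\nu=\nu$ for $\mu$-a.e. $A$. -/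

import Mathlib

open MeasureTheory Filter Topology
open scoped ENNReal MatrixGroups LinearAlgebra.Projectivization

namespace Furstenberg

/-- The real projective space of lines in `ℝ^d`, that is `P^{d-1}(ℝ)`. -/
abbrev Proj (d : ℕ) : Type := ℙ ℝ (Fin d → ℝ)

/-- Projective space carries the quotient topology from the nonzero vectors. -/
noncomputable instance instTopologicalSpaceProj (d : ℕ) : TopologicalSpace (Proj d) :=
  TopologicalSpace.coinduced
    (Projectivization.mk' ℝ : {v : Fin d → ℝ // v ≠ 0} → Proj d) inferInstance

noncomputable instance instMeasurableSpaceProj (d : ℕ) : MeasurableSpace (Proj d) := borel _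

instance instBorelSpaceProj (d : ℕ) : BorelSpace (Proj d) := ⟨rfl⟩

/-- `SL(d, ℝ)` carries the Borel sigma-algebra of its usual topology. -/
noncomputable instance instMeasurableSpaceSL (d : ℕ) : MeasurableSpace SL(d, ℝ) := borel _

instance instBorelSpaceSL (d : ℕ) : BorelSpace SL(d, ℝ) := ⟨rfl⟩

/-- The natural action of a matrix on projective space is continuous, so that the image
measures `ν.map (A • ·)` below are the genuine ones. -/
theorem continuous_smul_proj {d : ℕ} (A : SL(d, ℝ)) :
    Continuous (fun ξ : Proj d => A • ξ) := by
  refine continuous_coinduced_dom.2 ?_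
  have h : Continuous (fun v : {v : Fin d → ℝ // v ≠ 0} =>
      (⟨A • v.1, (smul_ne_zero_iff_ne A).mpr v.2⟩ : {v : Fin d → ℝ // v ≠ 0})) := by
    refine Continuous.subtype_mk ?_ _
    change Continuous (fun v : {v : Fin d → ℝ // v ≠ 0} => Matrix.mulVec A.1 v.1)
    exact Continuous.matrix_mulVec continuous_const continuous_subtype_val
  exact continuous_coinduced_rng.comp h

/-- The Euclidean operator norm of a matrix. -/
noncomputable def opNorm {d : ℕ} (A : SL(d, ℝ)) : ℝ :=
  ‖Matrix.toEuclideanCLM (n := Fin d) (𝕜 := ℝ) (A : Matrix (Fin d) (Fin d) ℝ)‖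

/-- The product `Z_n = x_{n-1} ⋯ x_0` of the first `n` matrices of a sequence. -/
def partialProd {d : ℕ} (x : ℕ → SL(d, ℝ)) : ℕ → SL(d, ℝ)
  | 0 => 1
  | n + 1 => x n * partialProd x n

/-- `γ = lim (1/n) log ‖Z_n‖` for almost every sequence of independent matrices of law `μ`. -/
def IsUpperExponent {d : ℕ} (μ : Measure SL(d, ℝ)) [IsProbabilityMeasure μ] (γ : ℝ) : Prop :=
  ∀ᵐ x ∂(Measure.infinitePi (fun _ : ℕ => μ)),
    Tendsto (fun n : ℕ => (1 / (n : ℝ)) * Real.log (opNorm (partialProd x n))) atTop (𝓝 γ)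

/-- `γ = -lim (1/n) log ‖Z_n⁻¹‖` for almost every sequence of independent matrices of
law `μ`. -/
def IsLowerExponent {d : ℕ} (μ : Measure SL(d, ℝ)) [IsProbabilityMeasure μ] (γ : ℝ) : Prop :=
  ∀ᵐ x ∂(Measure.infinitePi (fun _ : ℕ => μ)),
    Tendsto (fun n : ℕ => -((1 / (n : ℝ)) * Real.log (opNorm (partialProd x n)⁻¹)))
      atTop (𝓝 γ)

/-- The measure `ν` on projective space is `μ`-stationary: `ν = ∫ A_* ν dμ(A)`. -/
def IsStationary {d : ℕ} (μ : Measure SL(d, ℝ)) (ν : Measure (Proj d)) : Prop :=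
  ∀ s : Set (Proj d), MeasurableSet s → ν s = ∫⁻ A, (ν.map (fun ξ => A • ξ)) s ∂μ

open Classical in
/-- The contribution `∫ log (dA_*ν/dν)(Aξ) dν(ξ)` of one matrix `A` to the entropy, which is
`+∞` if `A_*ν` is not absolutely continuous with respect to `ν` or if the integrand is not
integrable. For a probability measure `ν` the integral is nonnegative by the Jensen inequality,
so no information is lost in passing to `[0, ∞]`. -/
noncomputable def entropyAt {d : ℕ} (ν : Measure (Proj d)) (A : SL(d, ℝ)) : ℝ≥0∞ :=
  if ν.map (fun ξ => A • ξ) ≪ ν ∧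
      Integrable
        (fun ξ => Real.log ((ν.map (fun ξ => A • ξ)).rnDeriv ν (A • ξ)).toReal) ν
  then ENNReal.ofReal
    (∫ ξ, Real.log ((ν.map (fun ξ => A • ξ)).rnDeriv ν (A • ξ)).toReal ∂ν)
  else ∞

/-- The Furstenberg entropy `κ(μ, ν) = ∫∫ log (dA_*ν/dν)(Aξ) dν(ξ) dμ(A)`, in `[0, ∞]`. -/
noncomputable def entropy {d : ℕ} (μ : Measure SL(d, ℝ)) (ν : Measure (Proj d)) : ℝ≥0∞ :=
  ∫⁻ A, entropyAt ν A ∂μ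

end Furstenberg

namespace Furstenberg

set_option linter.unusedSectionVars false

/-! For a finite measurable partition of projective space let H(B) be the Shannon entropy under ν of
its pullback by B. By stationarity the average of H(BA) over A equals H(B) minus the mean divergence
of A_*ν from ν on the pulled back partition (`integral_cellDiv`). Hence the mean of H(Z_k) never
increases with k, and it drops by almost κ whenever the pullback by Z_k is fine. Take cells of size
about exp(-nT) with T slightly above γ⁺ - γ⁻. Since Z_k distorts distances by at most a constant
times ‖Z_k‖‖Z_k⁻¹‖, the pullback is fine with probability close to one for every k from some fixed
k₀ up to n. About exp((d-1)nT) cells suffice, so the entropy starts below (d-1)nT + O(1) and stays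
nonnegative: this leaves room for n drops only if κ ≤ (d-1)T (`integral_maxDV_bound`). Fineness has
to be uniform in A, so the divergence is first replaced by `maxDV`, a maximum of finitely many
Donsker-Varadhan functionals of continuous functions; monotone convergence along a dense sequence
then bounds the entropy (`klDiv_le_iSup_maxDV`, `entropy_le`). The exponents exist by the
Furstenberg-Kesten theorem, proved here for subadditive gauges (`exists_ae_tendsto`). If γ⁺ = 0,
then γ⁻ = 0 because ‖A⁻¹‖ ≤ C‖A‖^d; a stationary measure exists by compactness, and its divergences
vanish, so it is invariant. -/

instance instSecondCountableTopologySL (d : ℕ) : SecondCountableTopology SL(d, ℝ) := by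
  have : SecondCountableTopology (Matrix (Fin d) (Fin d) ℝ) :=
    inferInstanceAs (SecondCountableTopology (Fin d → Fin d → ℝ))
  exact Matrix.SpecialLinearGroup.isClosedEmbedding_val.isEmbedding.secondCountableTopology

/-! ### Independent identically distributed sequences. -/

section Shift

variable {α : Type*} [MeasurableSpace α]

lemma measurePreserving_shift (μ : Measure α) [IsProbabilityMeasure μ] (k : ℕ) :
    MeasurePreserving (fun (x : ℕ → α) i => x (i + k))
      (Measure.infinitePi fun _ => μ) (Measure.infinitePi fun _ => μ) :=
  ⟨by fun_prop, Measure.map_infinitePi_infinitePi_of_inj (P := fun _ : ℕ => μ)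
    (f := fun i => i + k) (add_left_injective k)⟩

/-- A shift-invariant event for an independent identically distributed sequence is trivial. -/
lemma measure_zero_or_one_of_shift_invariant (μ : Measure α) [IsProbabilityMeasure μ]
    {s : Set (ℕ → α)} (hs : MeasurableSet s)
    (hinv : ∀ x : ℕ → α, (fun i => x (i + 1)) ∈ s ↔ x ∈ s) :
    Measure.infinitePi (fun _ : ℕ => μ) s = 0 ∨ Measure.infinitePi (fun _ : ℕ => μ) s = 1 := by
  have hindep : ProbabilityTheory.iIndepFun (fun (i : ℕ) (x : ℕ → α) => x i)
      (Measure.infinitePi (fun _ : ℕ => μ)) :=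
    ProbabilityTheory.iIndepFun_infinitePi (P := fun _ : ℕ => μ) (X := fun _ x => x)
      (by fun_prop)
  refine ProbabilityTheory.measure_zero_or_one_of_measurableSet_limsup_atTop
    (fun n => (measurable_pi_apply n).comap_le) hindep ?_
  -- An invariant event is its own preimage under every power of the shift, hence depends only on
  -- the coordinates from `n` on: it is a tail event and Kolmogorov's law applies.
  rw [limsup_eq_iInf_iSup_of_nat, MeasurableSpace.measurableSet_iInf]
  intro n
  have hinvn : ∀ x : ℕ → α, (fun i => x (i + n)) ∈ s ↔ x ∈ s := by
    induction n with
    | zero => simp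
    | succ n ih =>
      intro x
      rw [← hinv x, ← ih (fun i => x (i + 1))]
      simp only [add_assoc]
  have hm : @Measurable _ _
      (⨆ i ≥ n, MeasurableSpace.comap (fun x : ℕ → α => x i) inferInstance) _
      (fun (x : ℕ → α) i => x (i + n)) := by
    refine (@measurable_pi_iff _ _ _ (_) _ _).2 fun i => ?_
    have h1 : MeasurableSpace.comap (fun x : ℕ → α => x (i + n)) inferInstance ≤
        ⨆ i ≥ n, MeasurableSpace.comap (fun x : ℕ → α => x i) inferInstance :=
      le_iSup₂_of_le (i + n) (Nat.le_add_left n i) le_rfl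
    exact (comap_measurable _).mono h1 le_rfl
  have := hm hs
  rwa [show (fun (x : ℕ → α) i => x (i + n)) ⁻¹' s = s from Set.ext hinvn] at this

/-- The head and the tail of an independent identically distributed sequence are independent. -/
lemma map_head_tail (μ : Measure α) [IsProbabilityMeasure μ] :
    (Measure.infinitePi (fun _ : ℕ => μ)).map (fun x => (x 0, fun i => x (i + 1))) =
      μ.prod (Measure.infinitePi fun _ => μ) := by
  -- Splitting undoes prepending, so it is enough to identify the image of the product measure under
  -- `e`, which is done on cylinders.
  let e : α × (ℕ → α) → ℕ → α := fun p n => Nat.casesOn n p.1 p.2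
  have he : Measurable e := by
    rw [measurable_pi_iff]
    rintro (_ | n)
    · exact measurable_fst
    · exact (measurable_pi_apply n).comp measurable_snd
  have h : (μ.prod (Measure.infinitePi fun _ : ℕ => μ)).map e =
      Measure.infinitePi (fun _ : ℕ => μ) := by
    refine Measure.eq_infinitePi _ fun s t ht => ?_
    rw [Measure.map_apply he (.pi s.countable_toSet fun i _ => ht i)]
    classical
    have hpre : e ⁻¹' (Set.pi s t) = (if 0 ∈ s then t 0 else Set.univ) ×ˢ
        Set.pi (s.preimage (· + 1) (add_left_injective 1).injOn) (fun i => t (i + 1)) := by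
      ext ⟨a, x⟩
      simp only [Set.mem_preimage, Set.mem_pi, Set.mem_prod, Finset.mem_coe,
        Finset.mem_preimage]
      constructor
      · intro h
        refine ⟨?_, fun i hi => h (i + 1) hi⟩
        split_ifs with h0
        · exact h 0 h0
        · trivial
      · rintro ⟨h0, h1⟩ (_ | i) hi
        · rwa [if_pos hi] at h0
        · exact h1 i hi
    rw [hpre, Measure.prod_prod, Measure.infinitePi_pi _ (fun i _ => ht (i + 1))]
    rw [Finset.prod_preimage' (· + 1) s (add_left_injective 1).injOn (fun i => μ (t i))]
    have hs : s.filter (fun x => x ∈ Set.range (· + 1)) = s.erase 0 := by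
      ext i
      rcases i with _ | i <;> simp
    rw [hs]
    split_ifs with h0
    · exact Finset.mul_prod_erase s (fun i => μ (t i)) h0
    · simp [Finset.erase_eq_of_notMem h0]
  conv_lhs => rw [← h, Measure.map_map (by fun_prop) he]
  exact Measure.map_id

end Shift

/-! ### Subadditive gauges along random products. -/

section Kingman

variable {d : ℕ}

lemma partialProd_add (x : ℕ → SL(d, ℝ)) (m n : ℕ) :
    partialProd x (n + m) = partialProd (fun i => x (i + m)) n * partialProd x m := by
  induction n with
  | zero => simp [partialProd]
  | succ n ih =>
    rw [Nat.add_right_comm]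
    simp only [partialProd, ih, mul_assoc]

lemma partialProd_one (x : ℕ → SL(d, ℝ)) : partialProd x 1 = x 0 := by
  simp [partialProd]

lemma measurable_partialProd (n : ℕ) :
    Measurable (fun x : ℕ → SL(d, ℝ) => partialProd x n) := by
  induction n with
  | zero => exact measurable_const
  | succ n ih => exact (measurable_pi_apply n).mul ih

/-- A nonnegative measurable subadditive function with finite mean. -/
structure IsGauge (μ : Measure SL(d, ℝ)) (φ : SL(d, ℝ) → ℝ) : Prop where
  measurable : Measurable φ
  nonneg : ∀ A, 0 ≤ φ A
  map_one : φ 1 = 0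
  map_mul_le : ∀ A B, φ (A * B) ≤ φ A + φ B
  integrable : Integrable φ μ

variable {μ : Measure SL(d, ℝ)} [IsProbabilityMeasure μ] {φ : SL(d, ℝ) → ℝ}

namespace IsGauge

lemma le_sum (hφ : IsGauge μ φ) (x : ℕ → SL(d, ℝ)) (n : ℕ) :
    φ (partialProd x n) ≤ ∑ i ∈ Finset.range n, φ (x i) := by
  induction n with
  | zero => simp [partialProd, hφ.map_one]
  | succ n ih =>
    rw [Finset.sum_range_succ, add_comm (Finset.sum _ _)]
    exact (hφ.map_mul_le _ _).trans (add_le_add_right ih _)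

lemma measurable_comp_partialProd (hφ : IsGauge μ φ) (n : ℕ) :
    Measurable (fun x : ℕ → SL(d, ℝ) => φ (partialProd x n)) :=
  hφ.measurable.comp (measurable_partialProd n)

lemma integrable_apply (hφ : IsGauge μ φ) (i : ℕ) :
    Integrable (fun x : ℕ → SL(d, ℝ) => φ (x i)) (Measure.infinitePi fun _ => μ) :=
  (measurePreserving_eval_infinitePi (fun _ : ℕ => μ) i).integrable_comp_of_integrable
    hφ.integrable

lemma integrable_comp_partialProd (hφ : IsGauge μ φ) (n : ℕ) :
    Integrable (fun x : ℕ → SL(d, ℝ) => φ (partialProd x n)) (Measure.infinitePi fun _ => μ) := by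
  refine Integrable.mono' (integrable_finsetSum (Finset.range n) fun i _ => hφ.integrable_apply i)
    (hφ.measurable_comp_partialProd n).aestronglyMeasurable (ae_of_all _ fun x => ?_)
  rw [Real.norm_of_nonneg (hφ.nonneg _)]
  exact hφ.le_sum x n

lemma integral_apply (hφ : IsGauge μ φ) (i : ℕ) :
    ∫ x : ℕ → SL(d, ℝ), φ (x i) ∂(Measure.infinitePi fun _ => μ) = ∫ A, φ A ∂μ := by
  have h := measurePreserving_eval_infinitePi (fun _ : ℕ => μ) i
  conv_rhs => rw [← h.map_eq]
  rw [integral_map h.measurable.aemeasurable hφ.measurable.aestronglyMeasurable]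

/-- The mean of the gauge of the `n`-fold product. -/
noncomputable def mean (μ : Measure SL(d, ℝ)) (φ : SL(d, ℝ) → ℝ) (n : ℕ) : ℝ :=
  ∫ x, φ (partialProd x n) ∂(Measure.infinitePi fun _ : ℕ => μ)

lemma integral_shift (hφ : IsGauge μ φ) (m n : ℕ) :
    ∫ x : ℕ → SL(d, ℝ), φ (partialProd (fun i => x (i + m)) n)
      ∂(Measure.infinitePi fun _ => μ) = mean μ φ n := by
  have h := measurePreserving_shift μ m
  rw [mean]
  conv_rhs => rw [← h.map_eq]
  rw [integral_map h.measurable.aemeasurable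
    (hφ.measurable_comp_partialProd n).aestronglyMeasurable]

lemma mean_nonneg (hφ : IsGauge μ φ) (n : ℕ) : 0 ≤ mean μ φ n :=
  integral_nonneg fun _ => hφ.nonneg _

lemma subadditive_mean (hφ : IsGauge μ φ) : Subadditive (mean μ φ) := by
  intro m n
  have h := measurePreserving_shift μ m
  have hint : Integrable (fun x : ℕ → SL(d, ℝ) => φ (partialProd (fun i => x (i + m)) n))
      (Measure.infinitePi fun _ => μ) :=
    h.integrable_comp_of_integrable (hφ.integrable_comp_partialProd n)
  rw [add_comm m n, add_comm (mean μ φ m), ← hφ.integral_shift m n, mean, mean,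
    ← integral_add hint (hφ.integrable_comp_partialProd m)]
  refine integral_mono (hφ.integrable_comp_partialProd _)
    (hint.add (hφ.integrable_comp_partialProd m)) fun x => ?_
  simp only [partialProd_add]
  exact hφ.map_mul_le _ _

lemma bddBelow_mean (hφ : IsGauge μ φ) :
    BddBelow (Set.range fun n : ℕ => mean μ φ n / n) :=
  ⟨0, by rintro _ ⟨n, rfl⟩; exact div_nonneg (hφ.mean_nonneg n) n.cast_nonneg⟩

/-- The set of sequences whose normalized gauges have lower limit at most `t`. -/
def slowSet (φ : SL(d, ℝ) → ℝ) (t : ℝ) : Set (ℕ → SL(d, ℝ)) :=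
  {x | ∀ k : ℕ, ∃ᶠ n : ℕ in atTop, φ (partialProd x n) ≤ (t + 1 / ((k : ℝ) + 1)) * n}

lemma measurableSet_slowSet (hφ : IsGauge μ φ) (t : ℝ) : MeasurableSet (slowSet φ t) := by
  have : slowSet φ t = ⋂ k : ℕ, ⋂ N : ℕ, ⋃ n ≥ N,
      {x | φ (partialProd x n) ≤ (t + 1 / ((k : ℝ) + 1)) * n} := by
    ext x
    simp [slowSet, frequently_atTop]
  rw [this]
  exact .iInter fun k => .iInter fun N => .iUnion fun n => .iUnion fun _ =>
    measurableSet_le (hφ.measurable_comp_partialProd n) measurable_const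

/-- The constant and the index shifts are absorbed by relaxing the slack from 1/(k+2) to 1/(k+1),
which gains a positive multiple of `n`. -/
lemma frequently_of_frequently {u v : ℕ → ℝ} {t C : ℝ} {a b : ℕ}
    (h : ∀ n, v (n + a) ≤ u (n + b) + C)
    (hu : ∀ k : ℕ, ∃ᶠ n : ℕ in atTop, u n ≤ (t + 1 / ((k : ℝ) + 1)) * n) (k : ℕ) :
    ∃ᶠ n : ℕ in atTop, v n ≤ (t + 1 / ((k : ℝ) + 1)) * n := by
  have hlt : t + 1 / (((k + 1 : ℕ) : ℝ) + 1) < t + 1 / ((k : ℝ) + 1) := by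
    push_cast
    gcongr
    linarith
  set s := t + 1 / (((k + 1 : ℕ) : ℝ) + 1)
  set s' := t + 1 / ((k : ℝ) + 1)
  have hev : ∀ᶠ n : ℕ in atTop, s * ((n + b : ℕ) : ℝ) + C ≤ s' * ((n + a : ℕ) : ℝ) := by
    have h1 : Tendsto (fun n : ℕ => (s' - s) * (n : ℝ)) atTop atTop :=
      tendsto_natCast_atTop_atTop.const_mul_atTop (sub_pos.2 hlt)
    filter_upwards [h1.eventually_ge_atTop (s * b + C - s' * a)] with n hn
    push_cast
    linarith
  have hu' : ∃ᶠ n : ℕ in atTop, u (n + b) ≤ s * ((n + b : ℕ) : ℝ) := by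
    have := hu (k + 1)
    rw [← map_add_atTop_eq_nat b] at this
    exact frequently_map.1 this
  rw [← map_add_atTop_eq_nat a]
  refine frequently_map.2 ((hu'.and_eventually hev).mono fun n hn => ?_)
  exact (h n).trans (by linarith [hn.1, hn.2])

/-- Adding or removing the first factor costs at most the gauge of `x 0` or of its inverse, which
does not depend on `n`. -/
lemma mem_slowSet_shift (hφ : IsGauge μ φ) (t : ℝ) (x : ℕ → SL(d, ℝ)) :
    (fun i => x (i + 1)) ∈ slowSet φ t ↔ x ∈ slowSet φ t := by
  constructor
  · intro h
    refine frequently_of_frequently (a := 1) (b := 0) (C := φ (x 0)) (fun n => ?_) h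
    rw [partialProd_add, partialProd_one]
    exact hφ.map_mul_le _ _
  · intro h
    refine frequently_of_frequently (a := 0) (b := 1) (C := φ (x 0)⁻¹) (fun n => ?_) h
    have : partialProd (fun i => x (i + 1)) n = partialProd x (n + 1) * (x 0)⁻¹ := by
      rw [partialProd_add, partialProd_one, mul_inv_cancel_right]
    rw [add_zero, this]
    exact hφ.map_mul_le _ _

/-- The set of sequences with an early small normalized gauge. -/
def earlySet (φ : SL(d, ℝ) → ℝ) (c : ℝ) (M : ℕ) : Set (ℕ → SL(d, ℝ)) :=
  {x | ∃ k, 1 ≤ k ∧ k ≤ M ∧ φ (partialProd x k) ≤ c * k}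

lemma measurableSet_earlySet (hφ : IsGauge μ φ) (c : ℝ) (M : ℕ) :
    MeasurableSet (earlySet φ c M) := by
  have : earlySet φ c M = ⋃ k : ℕ, ⋃ _ : 1 ≤ k, ⋃ _ : k ≤ M,
      {x | φ (partialProd x k) ≤ c * k} := by
    ext x
    simp only [earlySet, Set.mem_ofPred_eq, Set.mem_iUnion, exists_prop]
  rw [this]
  exact .iUnion fun k => .iUnion fun _ => .iUnion fun _ =>
    measurableSet_le (hφ.measurable_comp_partialProd k) measurable_const

open Classical in
/-- Greedy decomposition of a product into early blocks and single factors. -/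
lemma le_greedy (hφ : IsGauge μ φ) {c : ℝ} (hc : 0 ≤ c) (M : ℕ) (n : ℕ) (x : ℕ → SL(d, ℝ)) :
    φ (partialProd x n) ≤ c * n
      + ∑ i ∈ Finset.range n, (if (fun j => x (j + i)) ∈ earlySet φ c M then 0 else φ (x i))
      + ∑ i ∈ Finset.range n, (if n ≤ i + M then φ (x i) else 0) := by
  induction n using Nat.strong_induction_on generalizing x with
  | _ n ih =>
  have hpos : ∀ (y : ℕ → SL(d, ℝ)) (s : Finset ℕ), 0 ≤ ∑ i ∈ s,
      (if (fun j => y (j + i)) ∈ earlySet φ c M then 0 else φ (y i)) := fun y s =>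
    Finset.sum_nonneg fun i _ => by split_ifs <;> simp [hφ.nonneg]
  have hpos' : ∀ (y : ℕ → SL(d, ℝ)) (s : Finset ℕ), 0 ≤ ∑ i ∈ s,
      (if n ≤ i + M then φ (y i) else 0) := fun y s =>
    Finset.sum_nonneg fun i _ => by split_ifs <;> simp [hφ.nonneg]
  have hcn : 0 ≤ c * n := by positivity
  by_cases hn : n ≤ M
  -- A product of length at most `M` lies in the window of the last `M` indices, where every factor
  -- is paid for.
  · have h1 : ∑ i ∈ Finset.range n, (if n ≤ i + M then φ (x i) else 0) =
        ∑ i ∈ Finset.range n, φ (x i) :=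
      Finset.sum_congr rfl fun i _ => if_pos (by omega)
    rw [h1]
    linarith [hφ.le_sum x n, hpos x (Finset.range n)]
  push Not at hn
  -- Cut off the first `k` factors and apply induction to the rest. The cut is an early block if
  -- there is one, and otherwise the single factor `x 0`, charged to the second sum. The window of
  -- the last `M` indices is anchored at the end, so cutting at the front does not move it.
  have key : ∀ k, 1 ≤ k → k ≤ n → φ (partialProd x k) ≤ c * k +
      ∑ i ∈ Finset.range k, (if (fun j => x (j + i)) ∈ earlySet φ c M then 0 else φ (x i)) →
      φ (partialProd x n) ≤ c * n
        + ∑ i ∈ Finset.range n, (if (fun j => x (j + i)) ∈ earlySet φ c M then 0 else φ (x i))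
        + ∑ i ∈ Finset.range n, (if n ≤ i + M then φ (x i) else 0) := by
    intro k hk1 hkn hk
    obtain ⟨m, rfl⟩ := Nat.exists_eq_add_of_le hkn
    have h1 := ih m (by omega) (fun i => x (i + k))
    have h2 : φ (partialProd x (k + m)) ≤
        φ (partialProd (fun i => x (i + k)) m) + φ (partialProd x k) := by
      rw [add_comm k m, partialProd_add]
      exact hφ.map_mul_le _ _
    rw [Finset.sum_range_add _ k m, Finset.sum_range_add _ k m]
    have h3 := hpos' x (Finset.range k)
    have e1 : ∀ i, (fun j => x (j + i + k)) = (fun j => x (j + (k + i))) := fun i => by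
      funext j; congr 1; omega
    have e2 : ∀ i, φ (x (i + k)) = φ (x (k + i)) := fun i => by rw [add_comm]
    have e3 : ∀ i, (m ≤ i + M) ↔ (k + m ≤ k + i + M) := fun i => by omega
    simp only [e1, e2] at h1
    simp only [e3] at h1
    push_cast
    linarith
  by_cases hx : x ∈ earlySet φ c M
  · obtain ⟨k, hk1, hkM, hk⟩ := hx
    exact key k hk1 (by omega) (hk.trans (le_add_of_nonneg_right (hpos x _)))
  · refine key 1 le_rfl (by omega) ?_
    rw [partialProd_one, Finset.sum_range_one]
    simp only [add_zero]
    rw [if_neg hx, Nat.cast_one, mul_one]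
    linarith

end IsGauge
end Kingman

/-! ### Furstenberg-Kesten theorem: the lower bound. -/

section KingmanLower

variable {d : ℕ} {μ : Measure SL(d, ℝ)} [IsProbabilityMeasure μ] {φ : SL(d, ℝ) → ℝ}

namespace IsGauge

open Classical in
/-- The cost of the first factor on sequences without an early small block. -/
noncomputable def lateCost (φ : SL(d, ℝ) → ℝ) (c : ℝ) (M : ℕ) (x : ℕ → SL(d, ℝ)) : ℝ :=
  if x ∈ earlySet φ c M then 0 else φ (x 0)

lemma measurable_lateCost (hφ : IsGauge μ φ) (c : ℝ) (M : ℕ) : Measurable (lateCost φ c M) :=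
  Measurable.ite (hφ.measurableSet_earlySet c M) measurable_const
    (hφ.measurable.comp (measurable_pi_apply 0))

lemma norm_lateCost_le (hφ : IsGauge μ φ) (c : ℝ) (M : ℕ) (x : ℕ → SL(d, ℝ)) :
    ‖lateCost φ c M x‖ ≤ φ (x 0) := by
  unfold lateCost
  split_ifs
  · simpa using hφ.nonneg _
  · exact (Real.norm_of_nonneg (hφ.nonneg _)).le

lemma integrable_lateCost (hφ : IsGauge μ φ) (c : ℝ) (M : ℕ) :
    Integrable (lateCost φ c M) (Measure.infinitePi fun _ : ℕ => μ) :=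
  (hφ.integrable_apply 0).mono' (hφ.measurable_lateCost c M).aestronglyMeasurable
    (ae_of_all _ (hφ.norm_lateCost_le c M))

lemma mean_le_greedy (hφ : IsGauge μ φ) {c : ℝ} (hc : 0 ≤ c) (M n : ℕ) :
    mean μ φ n ≤ c * n + n * ∫ x, lateCost φ c M x ∂(Measure.infinitePi fun _ : ℕ => μ)
      + M * ∫ A, φ A ∂μ := by
  set P := Measure.infinitePi fun _ : ℕ => μ
  have hshift : ∀ i : ℕ, MeasurePreserving (fun (x : ℕ → SL(d, ℝ)) j => x (j + i)) P P :=
    measurePreserving_shift μ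
  have hint1 : ∀ i, Integrable (fun x : ℕ → SL(d, ℝ) => lateCost φ c M (fun j => x (j + i))) P :=
    fun i => (hshift i).integrable_comp_of_integrable (hφ.integrable_lateCost c M)
  have hval1 : ∀ i, ∫ x : ℕ → SL(d, ℝ), lateCost φ c M (fun j => x (j + i)) ∂P =
      ∫ x, lateCost φ c M x ∂P := fun i => by
    conv_rhs => rw [← (hshift i).map_eq]
    rw [integral_map (hshift i).measurable.aemeasurable
      (hφ.measurable_lateCost c M).aestronglyMeasurable]
  have hint2 : ∀ i, Integrable (fun x : ℕ → SL(d, ℝ) => if n ≤ i + M then φ (x i) else 0) P :=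
    fun i => by
      split_ifs
      · exact hφ.integrable_apply i
      · exact integrable_zero _ _ _
  have hval2 : ∀ i, ∫ x : ℕ → SL(d, ℝ), (if n ≤ i + M then φ (x i) else 0) ∂P =
      if n ≤ i + M then ∫ A, φ A ∂μ else 0 := fun i => by
    split_ifs
    · exact hφ.integral_apply i
    · simp
  have hs1 : Integrable (fun x : ℕ → SL(d, ℝ) =>
      c * n + ∑ i ∈ Finset.range n, lateCost φ c M (fun j => x (j + i))) P :=
    (integrable_const _).add (integrable_finsetSum _ fun i _ => hint1 i)
  have hs2 : Integrable (fun x : ℕ → SL(d, ℝ) =>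
      ∑ i ∈ Finset.range n, (if n ≤ i + M then φ (x i) else 0)) P :=
    integrable_finsetSum _ fun i _ => hint2 i
  have hle : mean μ φ n ≤ ∫ x : ℕ → SL(d, ℝ), (c * n
      + ∑ i ∈ Finset.range n, lateCost φ c M (fun j => x (j + i))
      + ∑ i ∈ Finset.range n, (if n ≤ i + M then φ (x i) else 0)) ∂P := by
    refine integral_mono (hφ.integrable_comp_partialProd n)
      (hs1.add hs2) fun x => ?_
    have := hφ.le_greedy hc M n x
    simpa only [lateCost, zero_add] using this
  refine hle.trans ?_
  rw [integral_add hs1 hs2,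
    integral_add (integrable_const _) (integrable_finsetSum _ fun i _ => hint1 i),
    integral_finsetSum _ fun i _ => hint1 i, integral_finsetSum _ fun i _ => hint2 i]
  simp only [hval1, hval2, integral_const, probReal_univ, smul_eq_mul, one_mul,
    Finset.sum_const, Finset.card_range, nsmul_eq_mul]
  gcongr
  rw [← Finset.sum_filter, Finset.sum_const, nsmul_eq_mul]
  have hcard : ((Finset.range n).filter fun i => n ≤ i + M).card ≤ M := by
    calc _ ≤ (Finset.Ico (n - M) n).card := Finset.card_le_card fun i hi => by
          simp only [Finset.mem_filter, Finset.mem_range, Finset.mem_Ico] at hi ⊢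
          omega
      _ ≤ M := by rw [Nat.card_Ico]; omega
  exact mul_le_mul_of_nonneg_right (by exact_mod_cast hcard) (integral_nonneg hφ.nonneg)

lemma lim_le_add_integral_lateCost (hφ : IsGauge μ φ) {c : ℝ} (hc : 0 ≤ c) (M : ℕ) :
    hφ.subadditive_mean.lim ≤
      c + ∫ x, lateCost φ c M x ∂(Measure.infinitePi fun _ : ℕ => μ) := by
  set β := ∫ x, lateCost φ c M x ∂(Measure.infinitePi fun _ : ℕ => μ)
  have h1 : Tendsto (fun n : ℕ => c + β + (M * ∫ A, φ A ∂μ) / (n : ℝ)) atTop (𝓝 (c + β + 0)) :=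
    tendsto_const_nhds.add (tendsto_const_div_atTop_nhds_zero_nat _)
  rw [add_zero] at h1
  refine ge_of_tendsto h1 ?_
  filter_upwards [eventually_gt_atTop 0] with n hn
  refine (hφ.subadditive_mean.lim_le_div hφ.bddBelow_mean hn.ne').trans ?_
  have hn' : (0 : ℝ) < n := by exact_mod_cast hn
  rw [div_le_iff₀ hn']
  have := hφ.mean_le_greedy hc M n
  field_simp
  linarith

/-- By the zero-one law the alternative is full measure. Then almost every sequence has an early
block once `M` is large, the late cost tends to zero by dominated convergence, and the limit of the
normalized means would be at most `t`. -/
lemma measure_slowSet_eq_zero (hφ : IsGauge μ φ) {t : ℝ} (ht : 0 ≤ t)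
    (htl : t < hφ.subadditive_mean.lim) :
    Measure.infinitePi (fun _ : ℕ => μ) (slowSet φ t) = 0 := by
  refine (measure_zero_or_one_of_shift_invariant μ (hφ.measurableSet_slowSet t)
    (hφ.mem_slowSet_shift t)).resolve_right fun h1 => ?_
  have hae : ∀ᵐ x ∂(Measure.infinitePi fun _ : ℕ => μ), x ∈ slowSet φ t := by
    rwa [← mem_ae_iff_prob_eq_one (hφ.measurableSet_slowSet t)] at h1
  have hk : ∀ k : ℕ, hφ.subadditive_mean.lim ≤ t + 1 / ((k : ℝ) + 1) := by
    intro k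
    have hc : 0 ≤ t + 1 / ((k : ℝ) + 1) := by positivity
    have hlim : Tendsto (fun M : ℕ => t + 1 / ((k : ℝ) + 1) +
        ∫ x, lateCost φ (t + 1 / ((k : ℝ) + 1)) M x ∂(Measure.infinitePi fun _ : ℕ => μ))
        atTop (𝓝 (t + 1 / ((k : ℝ) + 1) + ∫ _, 0 ∂(Measure.infinitePi fun _ : ℕ => μ))) := by
      refine tendsto_const_nhds.add (tendsto_integral_of_dominated_convergence
        (fun x : ℕ → SL(d, ℝ) => φ (x 0))
        (fun M => (hφ.measurable_lateCost _ M).aestronglyMeasurable)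
        (hφ.integrable_apply 0) (fun M => ae_of_all _ (hφ.norm_lateCost_le _ M)) ?_)
      filter_upwards [hae] with x hx
      obtain ⟨n, hn1, hn⟩ := frequently_atTop.1 (hx k) 1
      refine tendsto_const_nhds.congr' ?_
      filter_upwards [eventually_ge_atTop n] with M hM
      exact (if_pos ⟨n, hn1, hM, hn⟩).symm
    rw [integral_zero, add_zero] at hlim
    exact ge_of_tendsto hlim (Eventually.of_forall fun M =>
      hφ.lim_le_add_integral_lateCost hc M)
  have hlim : Tendsto (fun k : ℕ => t + 1 / ((k : ℝ) + 1)) atTop (𝓝 (t + 0)) :=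
    tendsto_const_nhds.add tendsto_one_div_add_atTop_nhds_zero_nat
  rw [add_zero] at hlim
  exact absurd (ge_of_tendsto hlim (Eventually.of_forall hk)) (not_le.2 htl)

lemma ae_eventually_gt (hφ : IsGauge μ φ) {t : ℝ} (htl : t < hφ.subadditive_mean.lim) :
    ∀ᵐ x ∂(Measure.infinitePi fun _ : ℕ => μ), ∀ᶠ n : ℕ in atTop,
      t < φ (partialProd x n) / n := by
  -- The greedy bound needs a nonnegative rate; below zero the claim follows from the nonnegativity
  -- of the gauge.
  rcases lt_or_ge t 0 with ht | ht
  · exact ae_of_all _ fun x => Eventually.of_forall fun n =>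
      ht.trans_le (div_nonneg (hφ.nonneg _) n.cast_nonneg)
  · have h0 : ∀ᵐ x ∂(Measure.infinitePi fun _ : ℕ => μ), x ∉ slowSet φ t :=
      measure_eq_zero_iff_ae_notMem.1 (hφ.measure_slowSet_eq_zero ht htl)
    filter_upwards [h0] with x hx
    simp only [slowSet, Set.mem_ofPred_eq, not_forall, not_frequently, not_le] at hx
    obtain ⟨k, hk⟩ := hx
    filter_upwards [hk, eventually_gt_atTop 0] with n hn hn0
    have hn' : (0 : ℝ) < n := by exact_mod_cast hn0
    rw [lt_div_iff₀ hn']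
    refine lt_of_le_of_lt ?_ hn
    gcongr
    have : 0 < 1 / ((k : ℝ) + 1) := by positivity
    linarith

end IsGauge
end KingmanLower

/-! ### Furstenberg-Kesten theorem: the upper bound by the law of large numbers for blocks. -/

section KingmanUpper

variable {d : ℕ} {μ : Measure SL(d, ℝ)} [IsProbabilityMeasure μ] {φ : SL(d, ℝ) → ℝ}

namespace IsGauge

lemma le_blocks (hφ : IsGauge μ φ) (x : ℕ → SL(d, ℝ)) (m q : ℕ) :
    φ (partialProd x (q * m)) ≤
      ∑ j ∈ Finset.range q, φ (partialProd (fun i => x (i + j * m)) m) := by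
  induction q with
  | zero => simp [partialProd, hφ.map_one]
  | succ q ih =>
    rw [Finset.sum_range_succ, Nat.succ_mul, add_comm (q * m), partialProd_add,
      add_comm (Finset.sum _ _)]
    exact (hφ.map_mul_le _ _).trans (add_le_add_right ih _)

/-- The incomplete last block is bounded by its single factors, written as a difference of two
initial sums: the law of large numbers gives both the same slope, so the difference is o(n). -/
lemma le_blocks_add (hφ : IsGauge μ φ) (x : ℕ → SL(d, ℝ)) (m n : ℕ) :
    φ (partialProd x n) ≤
      ∑ j ∈ Finset.range (n / m), φ (partialProd (fun i => x (i + j * m)) m)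
      + (∑ i ∈ Finset.range n, φ (x i) - ∑ i ∈ Finset.range (n / m * m), φ (x i)) := by
  obtain ⟨r, hr⟩ := Nat.exists_eq_add_of_le (Nat.div_mul_le_self n m)
  have h1 := hφ.le_blocks x m (n / m)
  have h2 := hφ.le_sum (fun i => x (i + n / m * m)) r
  have h3 : φ (partialProd x n) ≤ φ (partialProd (fun i => x (i + n / m * m)) r)
      + φ (partialProd x (n / m * m)) := by
    conv_lhs => rw [hr, add_comm, partialProd_add]
    exact hφ.map_mul_le _ _
  have h4 : ∑ i ∈ Finset.range n, φ (x i) = ∑ i ∈ Finset.range (n / m * m), φ (x i)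
      + ∑ i ∈ Finset.range r, φ (x (i + n / m * m)) := by
    conv_lhs => rw [hr, Finset.sum_range_add]
    simp only [add_comm]
  linarith

lemma partialProd_congr {x y : ℕ → SL(d, ℝ)} {n : ℕ} (h : ∀ i < n, x i = y i) :
    partialProd x n = partialProd y n := by
  induction n with
  | zero => rfl
  | succ n ih =>
    simp only [partialProd, h n (Nat.lt_succ_self n),
      ih fun i hi => h i (hi.trans (Nat.lt_succ_self n))]

/-- Distinct blocks read disjoint sets of coordinates. The map `ext` completes a block by ones, so
that its gauge becomes a measurable function of those coordinates alone. -/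
lemma indepFun_blocks (hφ : IsGauge μ φ) (m : ℕ) :
    Pairwise fun j k => ProbabilityTheory.IndepFun
      (fun x : ℕ → SL(d, ℝ) => φ (partialProd (fun i => x (i + j * m)) m))
      (fun x : ℕ → SL(d, ℝ) => φ (partialProd (fun i => x (i + k * m)) m))
      (Measure.infinitePi fun _ => μ) := by
  have hindep : ProbabilityTheory.iIndepFun (fun (i : ℕ) (x : ℕ → SL(d, ℝ)) => x i)
      (Measure.infinitePi (fun _ : ℕ => μ)) :=
    ProbabilityTheory.iIndepFun_infinitePi (P := fun _ : ℕ => μ) (X := fun _ x => x)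
      (by fun_prop)
  let S : ℕ → Finset ℕ := fun j => Finset.Ico (j * m) (j * m + m)
  have hS : ∀ j k, j < k → Disjoint (S j) (S k) := fun j k hjk => by
    rw [Finset.disjoint_left]
    intro i hi hi'
    simp only [S, Finset.mem_Ico] at hi hi'
    have : (j + 1) * m ≤ k * m := Nat.mul_le_mul_right m hjk
    rw [Nat.succ_mul] at this
    omega
  let ext : ∀ j, (S j → SL(d, ℝ)) → ℕ → SL(d, ℝ) := fun j y i =>
    if h : i + j * m ∈ S j then y ⟨i + j * m, h⟩ else 1
  have hext : ∀ j, Measurable fun y => φ (partialProd (ext j y) m) := fun j => by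
    refine (hφ.measurable_comp_partialProd m).comp (measurable_pi_iff.2 fun i => ?_)
    by_cases h : i + j * m ∈ S j
    · simp only [ext, h, dif_pos]
      exact measurable_pi_apply _
    · simp only [ext, h, dif_neg, not_false_eq_true]
      exact measurable_const
  have hcomp : ∀ j, (fun x : ℕ → SL(d, ℝ) => φ (partialProd (fun i => x (i + j * m)) m)) =
      (fun y => φ (partialProd (ext j y) m)) ∘ (fun x (i : S j) => x i) := fun j => by
    funext x
    refine congrArg φ (partialProd_congr fun i hi => ?_)
    have : i + j * m ∈ S j := by simp only [S, Finset.mem_Ico]; omega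
    simp only [ext, this, dif_pos]
  have hlt : ∀ j k, Disjoint (S j) (S k) → ProbabilityTheory.IndepFun
      (fun x : ℕ → SL(d, ℝ) => φ (partialProd (fun i => x (i + j * m)) m))
      (fun x : ℕ → SL(d, ℝ) => φ (partialProd (fun i => x (i + k * m)) m))
      (Measure.infinitePi fun _ => μ) := fun j k hjk => by
    rw [hcomp j, hcomp k]
    exact (hindep.indepFun_finset (S j) (S k) hjk (fun i => measurable_pi_apply i)).comp
      (hext j) (hext k)
  intro j k hjk
  rcases lt_or_gt_of_ne hjk with h | h
  · exact hlt j k (hS j k h)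
  · exact hlt j k (hS k j h).symm

lemma ae_tendsto_blocks (hφ : IsGauge μ φ) (m : ℕ) :
    ∀ᵐ x ∂(Measure.infinitePi fun _ : ℕ => μ), Tendsto (fun n : ℕ =>
      (∑ j ∈ Finset.range n, φ (partialProd (fun i => x (i + j * m)) m)) / n)
      atTop (𝓝 (mean μ φ m)) := by
  have hmeas : ∀ j, Measurable fun x : ℕ → SL(d, ℝ) =>
      φ (partialProd (fun i => x (i + j * m)) m) := fun j =>
    (hφ.measurable_comp_partialProd m).comp (measurePreserving_shift μ (j * m)).measurable
  have h := ProbabilityTheory.strong_law_ae_real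
    (μ := Measure.infinitePi fun _ : ℕ => μ)
    (fun j (x : ℕ → SL(d, ℝ)) => φ (partialProd (fun i => x (i + j * m)) m))
    (by simpa using hφ.integrable_comp_partialProd m) (hφ.indepFun_blocks m) (fun j => ?_)
  · simpa [mean] using h
  · refine ⟨(hmeas j).aemeasurable, (hmeas 0).aemeasurable, ?_⟩
    have : ∀ j, Measure.map (fun x : ℕ → SL(d, ℝ) =>
        φ (partialProd (fun i => x (i + j * m)) m)) (Measure.infinitePi fun _ : ℕ => μ) =
        Measure.map (fun x => φ (partialProd x m)) (Measure.infinitePi fun _ : ℕ => μ) := by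
      intro j
      conv_rhs => rw [← (measurePreserving_shift μ (j * m)).map_eq]
      rw [Measure.map_map (hφ.measurable_comp_partialProd m)
        (measurePreserving_shift μ (j * m)).measurable]
      rfl
    rw [this j, this 0]

lemma tendsto_div_div_atTop {m : ℕ} (hm : m ≠ 0) :
    Tendsto (fun n : ℕ => ((n / m : ℕ) : ℝ) / n) atTop (𝓝 (1 / (m : ℝ))) := by
  have hm' : (0 : ℝ) < m := by exact_mod_cast hm.bot_lt
  have h := (tendsto_nat_floor_mul_div_atTop (R := ℝ) (a := 1 / (m : ℝ)) (by positivity)).comp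
    tendsto_natCast_atTop_atTop
  refine h.congr fun n => ?_
  simp only [Function.comp]
  rw [one_div, inv_mul_eq_div, Nat.floor_div_natCast, Nat.floor_natCast]

/-- Some `m` has `mean μ φ m / m < t`, and the strong law for blocks of length `m` makes this
quotient an asymptotic upper bound. -/
lemma ae_eventually_lt (hφ : IsGauge μ φ) {t : ℝ} (htl : hφ.subadditive_mean.lim < t) :
    ∀ᵐ x ∂(Measure.infinitePi fun _ : ℕ => μ), ∀ᶠ n : ℕ in atTop,
      φ (partialProd x n) / n < t := by
  obtain ⟨m, hmt, hm0⟩ := (((hφ.subadditive_mean.tendsto_lim hφ.bddBelow_mean).eventually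
    (gt_mem_nhds htl)).and (eventually_gt_atTop 0)).exists
  have hm : m ≠ 0 := hm0.ne'
  have hq : Tendsto (fun n : ℕ => n / m) atTop atTop := Nat.tendsto_div_const_atTop hm
  filter_upwards [hφ.ae_tendsto_blocks m, hφ.ae_tendsto_blocks 1] with x hx hx1
  simp only [partialProd_one, zero_add, mul_one] at hx1
  have h1 : Tendsto (fun n : ℕ =>
      (∑ j ∈ Finset.range (n / m), φ (partialProd (fun i => x (i + j * m)) m)) /
        (n / m : ℕ) * (((n / m : ℕ) : ℝ) / n)
      + ((∑ i ∈ Finset.range n, φ (x i)) / n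
        - (∑ i ∈ Finset.range (n / m * m), φ (x i)) / (n / m * m : ℕ)
          * ((((n / m : ℕ) : ℝ) / n) * m))) atTop
      (𝓝 (mean μ φ m * (1 / (m : ℝ)) +
        (mean μ φ 1 - mean μ φ 1 * (1 / (m : ℝ) * m)))) :=
    ((hx.comp hq).mul (tendsto_div_div_atTop hm)).add (hx1.sub
      ((hx1.comp (hq.atTop_mul_const' hm0)).mul ((tendsto_div_div_atTop hm).mul_const _)))
  have hm' : (m : ℝ) ≠ 0 := by exact_mod_cast hm
  rw [one_div_mul_cancel hm', mul_one, sub_self, add_zero, mul_one_div] at h1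
  filter_upwards [h1.eventually (gt_mem_nhds hmt), eventually_ge_atTop m] with n hn hmn
  refine lt_of_le_of_lt ?_ hn
  have hn0 : (n : ℝ) ≠ 0 := by exact_mod_cast (hm0.trans_le hmn).ne'
  have hq0 : ((n / m : ℕ) : ℝ) ≠ 0 := by exact_mod_cast (Nat.div_pos hmn hm0).ne'
  have hle := hφ.le_blocks_add x m n
  calc φ (partialProd x n) / n ≤ _ := div_le_div_of_nonneg_right hle n.cast_nonneg
    _ = _ := by push_cast; field_simp

/-- The **Furstenberg-Kesten theorem** for products of independent identically distributed
matrices, with a general subadditive gauge in place of the logarithm of the norm. -/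
theorem exists_ae_tendsto (hφ : IsGauge μ φ) :
    ∃ γ : ℝ, 0 ≤ γ ∧ ∀ᵐ x ∂(Measure.infinitePi fun _ : ℕ => μ),
      Tendsto (fun n : ℕ => 1 / (n : ℝ) * φ (partialProd x n)) atTop (𝓝 γ) := by
  refine ⟨hφ.subadditive_mean.lim, ?_, ?_⟩
  · exact ge_of_tendsto' (hφ.subadditive_mean.tendsto_lim hφ.bddBelow_mean)
      fun n => div_nonneg (hφ.mean_nonneg n) n.cast_nonneg
  · set γ := hφ.subadditive_mean.lim
    have hlow : ∀ᵐ x ∂(Measure.infinitePi fun _ : ℕ => μ), ∀ k : ℕ, ∀ᶠ n : ℕ in atTop,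
        γ - 1 / ((k : ℝ) + 1) < φ (partialProd x n) / n := ae_all_iff.2 fun k =>
      hφ.ae_eventually_gt (sub_lt_self _ (by positivity))
    have hup : ∀ᵐ x ∂(Measure.infinitePi fun _ : ℕ => μ), ∀ k : ℕ, ∀ᶠ n : ℕ in atTop,
        φ (partialProd x n) / n < γ + 1 / ((k : ℝ) + 1) := ae_all_iff.2 fun k =>
      hφ.ae_eventually_lt (lt_add_of_pos_right _ (by positivity))
    filter_upwards [hlow, hup] with x h1 h2
    simp only [one_div_mul_eq_div]
    rw [tendsto_order]
    constructor
    · intro a ha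
      obtain ⟨k, hk⟩ := exists_nat_one_div_lt (sub_pos.2 ha)
      filter_upwards [h1 k] with n hn
      linarith
    · intro a ha
      obtain ⟨k, hk⟩ := exists_nat_one_div_lt (sub_pos.2 ha)
      filter_upwards [h2 k] with n hn
      linarith

end IsGauge
end KingmanUpper

/-! ### Norms of unimodular matrices and of their inverses. -/

section OpNorm

variable {d : ℕ}

lemma opNorm_nonneg (A : SL(d, ℝ)) : 0 ≤ opNorm A := norm_nonneg _

lemma opNorm_mul_le (A B : SL(d, ℝ)) : opNorm (A * B) ≤ opNorm A * opNorm B := by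
  unfold opNorm
  rw [Matrix.SpecialLinearGroup.coe_mul, map_mul]
  exact norm_mul_le _ _

lemma opNorm_one [NeZero d] : opNorm (1 : SL(d, ℝ)) = 1 := by
  unfold opNorm
  rw [Matrix.SpecialLinearGroup.coe_one, map_one]
  exact norm_one

lemma abs_apply_le_opNorm (A : SL(d, ℝ)) (i j : Fin d) : |A.1 i j| ≤ opNorm A := by
  have h1 := (Matrix.toEuclideanCLM (n := Fin d) (𝕜 := ℝ) A.1).le_opNorm
    (EuclideanSpace.single j (1 : ℝ))
  rw [PiLp.norm_single, norm_one, mul_one] at h1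
  have h2 := PiLp.norm_apply_le
    (Matrix.toEuclideanCLM (n := Fin d) (𝕜 := ℝ) A.1 (EuclideanSpace.single j (1 : ℝ))) i
  have h3 : Matrix.toEuclideanCLM (n := Fin d) (𝕜 := ℝ) A.1
      (EuclideanSpace.single j (1 : ℝ)) i = A.1 i j := by
    simp [Matrix.ofLp_toEuclideanCLM]
  rw [h3, Real.norm_eq_abs] at h2
  exact h2.trans h1

lemma continuous_opNorm : Continuous (opNorm : SL(d, ℝ) → ℝ) := by
  have h : Continuous (Matrix.toEuclideanCLM (n := Fin d) (𝕜 := ℝ)) := by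
    let e : (Fin d → Fin d → ℝ) →ₗ[ℝ] (EuclideanSpace ℝ (Fin d) →L[ℝ] EuclideanSpace ℝ (Fin d)) :=
      (Matrix.toEuclideanCLM (n := Fin d) (𝕜 := ℝ)).toAlgEquiv.toLinearMap
    exact e.continuous_of_finiteDimensional
  exact continuous_norm.comp (h.comp Matrix.SpecialLinearGroup.isClosedEmbedding_val.continuous)

lemma exists_opNorm_le (d : ℕ) : ∃ C : ℝ, 0 < C ∧ ∀ (A : SL(d, ℝ)) (x : ℝ), 0 ≤ x →
    (∀ i j, |A.1 i j| ≤ x) → opNorm A ≤ C * x := by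
  let e : (Fin d → Fin d → ℝ) →ₗ[ℝ] (EuclideanSpace ℝ (Fin d) →L[ℝ] EuclideanSpace ℝ (Fin d)) :=
    (Matrix.toEuclideanCLM (n := Fin d) (𝕜 := ℝ)).toAlgEquiv.toLinearMap
  refine ⟨‖e.toContinuousLinearMap‖ + 1, by positivity, fun A x hx h => ?_⟩
  let a : Fin d → Fin d → ℝ := A.1
  have h1 : opNorm A ≤ ‖e.toContinuousLinearMap‖ * ‖a‖ := e.toContinuousLinearMap.le_opNorm a
  have h2 : ‖a‖ ≤ x :=
    (pi_norm_le_iff_of_nonneg hx).2 fun i => (pi_norm_le_iff_of_nonneg hx).2 fun j => h i j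
  calc opNorm A ≤ ‖e.toContinuousLinearMap‖ * ‖a‖ := h1
    _ ≤ (‖e.toContinuousLinearMap‖ + 1) * x := by gcongr; linarith

/-- A norm below one would force the powers of `A` to zero, hence their determinants too, but these
are all one. -/
lemma one_le_opNorm [NeZero d] (A : SL(d, ℝ)) : 1 ≤ opNorm A := by
  by_contra! h
  have hpow : ∀ n : ℕ, opNorm (A ^ n) ≤ opNorm A ^ n := fun n => by
    induction n with
    | zero => simp [opNorm_one]
    | succ n ih =>
      rw [pow_succ, pow_succ]
      exact (opNorm_mul_le _ _).trans (mul_le_mul_of_nonneg_right ih (opNorm_nonneg A))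
  have h0 : Tendsto (fun n : ℕ => (A ^ n).1) atTop (𝓝 (0 : Matrix (Fin d) (Fin d) ℝ)) := by
    refine tendsto_pi_nhds.2 fun i => tendsto_pi_nhds.2 fun j => ?_
    refine squeeze_zero_norm (fun n => ?_)
      (tendsto_pow_atTop_nhds_zero_of_lt_one (opNorm_nonneg A) h)
    exact (abs_apply_le_opNorm (A ^ n) i j).trans (hpow n)
  have h1 : Tendsto (fun n : ℕ => (A ^ n).1.det) atTop
      (𝓝 (0 : Matrix (Fin d) (Fin d) ℝ).det) :=
    ((continuous_id.matrix_det).tendsto _).comp h0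
  have h2 : (fun n : ℕ => (A ^ n).1.det) = fun _ => 1 := funext fun n => (A ^ n).2
  rw [h2, Matrix.det_zero] at h1
  exact one_ne_zero (tendsto_nhds_unique tendsto_const_nhds h1)

/-- The entries of the inverse are cofactors, bounded by the Leibniz formula. The exponent is `d`
and not `d - 1` because the row replaced by a unit vector is also bounded by `opNorm A`, which is at
least one. -/
lemma exists_opNorm_inv_le (d : ℕ) [NeZero d] : ∃ C : ℝ, 1 ≤ C ∧ ∀ A : SL(d, ℝ),
    opNorm A⁻¹ ≤ C * opNorm A ^ d := by
  obtain ⟨C, hC0, hC⟩ := exists_opNorm_le d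
  have key : ∀ A : SL(d, ℝ), opNorm A⁻¹ ≤ C * d.factorial * opNorm A ^ d := by
    intro A
    rw [mul_assoc]
    refine hC _ _ (mul_nonneg (Nat.cast_nonneg _) (pow_nonneg (opNorm_nonneg A) d)) fun i j => ?_
    rw [Matrix.SpecialLinearGroup.coe_inv, Matrix.adjugate_apply]
    have := Matrix.det_le (A := A.1.updateRow j (Pi.single i 1)) (abv := AbsoluteValue.abs)
      (x := opNorm A) (fun k l => ?_)
    · simpa using this
    · rcases eq_or_ne k j with rfl | hk
      · rw [Matrix.updateRow_self]
        rcases eq_or_ne l i with rfl | hl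
        · simpa using one_le_opNorm A
        · simpa [hl] using opNorm_nonneg A
      · rw [Matrix.updateRow_ne hk]
        exact abs_apply_le_opNorm A k l
  refine ⟨C * d.factorial, ?_, key⟩
  simpa [opNorm_one] using key 1

/-- In dimension two the adjugate is the adjoint conjugated by the rotation `J` through a right
angle, and the adjoint has the same norm. -/
lemma opNorm_inv_eq_of_two (A : SL(2, ℝ)) : opNorm A⁻¹ = opNorm A := by
  have key : ∀ A : SL(2, ℝ), opNorm A⁻¹ ≤ opNorm A := by
    intro A
    let J : Matrix (Fin 2) (Fin 2) ℝ := !![0, 1; -1, 0]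
    have hJ : star J * J = 1 := by
      ext i j
      fin_cases i <;> fin_cases j <;>
        simp [J, Matrix.star_eq_conjTranspose, Matrix.mul_apply, Fin.sum_univ_two]
    have hJ' : ‖Matrix.toEuclideanCLM (n := Fin 2) (𝕜 := ℝ) J‖ ≤ 1 := by
      have h := CStarRing.norm_star_mul_self (x := Matrix.toEuclideanCLM (n := Fin 2) (𝕜 := ℝ) J)
      rw [← map_star, ← map_mul, hJ, map_one, norm_one] at h
      nlinarith [norm_nonneg (Matrix.toEuclideanCLM (n := Fin 2) (𝕜 := ℝ) J)]
    have hA : (A⁻¹ : SL(2, ℝ)).1 = star J * star A.1 * J := by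
      rw [Matrix.SpecialLinearGroup.coe_inv, Matrix.adjugate_fin_two]
      ext i j
      fin_cases i <;> fin_cases j <;>
        simp [J, Matrix.star_eq_conjTranspose, Matrix.mul_apply, Fin.sum_univ_two]
    unfold opNorm
    have hs : ∀ T : EuclideanSpace ℝ (Fin 2) →L[ℝ] EuclideanSpace ℝ (Fin 2), ‖star T‖ = ‖T‖ :=
      fun T => norm_star T
    rw [hA, map_mul, map_mul, map_star, map_star]
    calc _ ≤ ‖star (Matrix.toEuclideanCLM (n := Fin 2) (𝕜 := ℝ) J)‖
          * ‖star (Matrix.toEuclideanCLM (n := Fin 2) (𝕜 := ℝ) A.1)‖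
          * ‖Matrix.toEuclideanCLM (n := Fin 2) (𝕜 := ℝ) J‖ :=
        (norm_mul_le _ _).trans (mul_le_mul_of_nonneg_right (norm_mul_le _ _) (norm_nonneg _))
      _ ≤ 1 * ‖Matrix.toEuclideanCLM (n := Fin 2) (𝕜 := ℝ) A.1‖ * 1 := by
        exact mul_le_mul (mul_le_mul ((hs _).trans_le hJ') (hs _).le (norm_nonneg _) zero_le_one)
          hJ' (norm_nonneg _) (by rw [one_mul]; exact norm_nonneg _)
      _ = _ := by ring
  refine le_antisymm (key A) ?_
  simpa using key A⁻¹

/-- Vectors carry the sup norm here while `opNorm` is Euclidean. The crude factor `d` is harmless,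
since only exponential rates matter. -/
lemma norm_mulVec_le (A : SL(d, ℝ)) (v : Fin d → ℝ) :
    ‖A • v‖ ≤ d * opNorm A * ‖v‖ := by
  refine (pi_norm_le_iff_of_nonneg (mul_nonneg (mul_nonneg d.cast_nonneg (opNorm_nonneg A))
    (norm_nonneg v))).2 fun i => ?_
  change ‖∑ j, A.1 i j * v j‖ ≤ _
  calc ‖∑ j, A.1 i j * v j‖ ≤ ∑ j : Fin d, opNorm A * ‖v‖ := norm_sum_le_of_le _ fun j _ => by
        rw [norm_mul]
        exact mul_le_mul (abs_apply_le_opNorm A i j) (norm_le_pi_norm v j) (norm_nonneg _)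
          (opNorm_nonneg A)
    _ = _ := by simp [mul_assoc]

lemma isGauge_log_opNorm [NeZero d] {μ : Measure SL(d, ℝ)}
    (h : Integrable (fun A => Real.log (opNorm A)) μ) :
    IsGauge μ fun A => Real.log (opNorm A) where
  measurable := Real.measurable_log.comp continuous_opNorm.measurable
  nonneg A := Real.log_nonneg (one_le_opNorm A)
  map_one := by rw [opNorm_one, Real.log_one]
  map_mul_le A B := by
    have hA := one_le_opNorm A
    have hB := one_le_opNorm B
    rw [← Real.log_mul (by positivity) (by positivity)]
    exact Real.log_le_log (zero_lt_one.trans_le (one_le_opNorm _)) (opNorm_mul_le A B)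
  integrable := h

lemma exists_log_opNorm_inv_le (d : ℕ) [NeZero d] : ∃ C : ℝ, 0 ≤ C ∧ ∀ A : SL(d, ℝ),
    Real.log (opNorm A⁻¹) ≤ C + d * Real.log (opNorm A) := by
  obtain ⟨C, hC1, hC⟩ := exists_opNorm_inv_le d
  refine ⟨Real.log C, Real.log_nonneg hC1, fun A => ?_⟩
  have hA := one_le_opNorm A
  rw [← Real.log_pow, ← Real.log_mul (by positivity) (by positivity)]
  exact Real.log_le_log (zero_lt_one.trans_le (one_le_opNorm _)) (hC A)

lemma isGauge_log_opNorm_inv [NeZero d] {μ : Measure SL(d, ℝ)} [IsProbabilityMeasure μ]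
    (h : Integrable (fun A => Real.log (opNorm A)) μ) :
    IsGauge μ fun A => Real.log (opNorm A⁻¹) where
  measurable := Real.measurable_log.comp (continuous_opNorm.comp continuous_inv).measurable
  nonneg A := Real.log_nonneg (one_le_opNorm _)
  map_one := by rw [inv_one, opNorm_one, Real.log_one]
  map_mul_le A B := by
    rw [mul_inv_rev, add_comm]
    exact (isGauge_log_opNorm h).map_mul_le B⁻¹ A⁻¹
  integrable := by
    obtain ⟨C, hC0, hC⟩ := exists_log_opNorm_inv_le d
    refine Integrable.mono' ((integrable_const C).add (h.const_mul (d : ℝ)))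
      (Real.measurable_log.comp
        (continuous_opNorm.comp continuous_inv).measurable).aestronglyMeasurable
      (ae_of_all _ fun A => ?_)
    rw [Real.norm_of_nonneg (Real.log_nonneg (one_le_opNorm _))]
    exact hC A

end OpNorm

/-! ### Topology of projective space through the Veronese embedding. -/

section ProjTopology

variable {d : ℕ}

/-- The Veronese coordinates `v_i v_j / |v|²` of the line through `v`. -/
noncomputable def veronese (ξ : Proj d) : Fin d → Fin d → ℝ := fun i j =>
  ξ.rep i * ξ.rep j / ∑ k, ξ.rep k ^ 2

lemma sum_sq_pos {v : Fin d → ℝ} (hv : v ≠ 0) : 0 < ∑ k, v k ^ 2 := by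
  obtain ⟨i, hi⟩ := Function.ne_iff.1 hv
  exact Finset.sum_pos' (fun k _ => sq_nonneg _) ⟨i, Finset.mem_univ i, sq_pos_of_ne_zero hi⟩

lemma veronese_mk (v : Fin d → ℝ) (hv : v ≠ 0) (i j : Fin d) :
    veronese (Projectivization.mk ℝ v hv) i j = v i * v j / ∑ k, v k ^ 2 := by
  obtain ⟨a, ha⟩ := Projectivization.exists_smul_eq_mk_rep ℝ v hv
  have ha' : (a : ℝ) ≠ 0 := a.ne_zero
  have hs := (sum_sq_pos hv).ne'
  unfold veronese
  rw [← ha]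
  simp only [Pi.smul_apply, Units.smul_def, smul_eq_mul, mul_pow, ← Finset.mul_sum]
  field_simp

lemma continuous_mk : Continuous (Projectivization.mk' ℝ : {v : Fin d → ℝ // v ≠ 0} → Proj d) :=
  continuous_coinduced_rng

lemma continuous_veronese : Continuous (veronese : Proj d → Fin d → Fin d → ℝ) := by
  refine continuous_coinduced_dom.2 (continuous_pi fun i => continuous_pi fun j => ?_)
  have : (fun v : {v : Fin d → ℝ // v ≠ 0} => veronese (Projectivization.mk' ℝ v) i j) =
      fun v => v.1 i * v.1 j / ∑ k, v.1 k ^ 2 := funext fun v => veronese_mk v.1 v.2 i j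
  change Continuous fun v : {v : Fin d → ℝ // v ≠ 0} => veronese (Projectivization.mk' ℝ v) i j
  rw [this]
  have hc : ∀ i, Continuous fun v : {v : Fin d → ℝ // v ≠ 0} => v.1 i := fun i =>
    (continuous_apply i).comp continuous_subtype_val
  exact ((hc i).mul (hc j)).div (continuous_finsetSum _ fun k _ => (hc k).pow 2)
    fun v => (sum_sq_pos v.2).ne'

lemma veronese_self_mul_self (ξ : Proj d) (i j : Fin d) :
    veronese ξ i j ^ 2 = veronese ξ i i * veronese ξ j j := by
  unfold veronese
  ring

lemma veronese_self_nonneg (ξ : Proj d) (i : Fin d) : 0 ≤ veronese ξ i i :=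
  div_nonneg (mul_self_nonneg _) (Finset.sum_nonneg fun _ _ => sq_nonneg _)

lemma exists_veronese_pos (ξ : Proj d) : ∃ i, 0 < veronese ξ i i := by
  obtain ⟨i, hi⟩ := Function.ne_iff.1 ξ.rep_nonzero
  refine ⟨i, div_pos (mul_self_pos.2 hi) (sum_sq_pos ξ.rep_nonzero)⟩

/-- A nonzero diagonal Veronese coordinate gives an affine representative of the line. -/
lemma mk_veronese_div (ξ : Proj d) (i : Fin d) (hi : 0 < veronese ξ i i)
    (h : (fun j => veronese ξ i j / veronese ξ i i) ≠ 0) :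
    Projectivization.mk ℝ (fun j => veronese ξ i j / veronese ξ i i) h = ξ := by
  conv_rhs => rw [← ξ.mk_rep]
  rw [Projectivization.mk_eq_mk_iff']
  have hs := (sum_sq_pos ξ.rep_nonzero).ne'
  have hr : ξ.rep i ≠ 0 := by
    intro h0
    simp [veronese, h0] at hi
  refine ⟨(ξ.rep i)⁻¹, funext fun j => ?_⟩
  simp only [veronese, Pi.smul_apply, smul_eq_mul]
  field_simp

lemma veronese_div_ne_zero (ξ : Proj d) (i : Fin d) (hi : 0 < veronese ξ i i) :
    (fun j => veronese ξ i j / veronese ξ i i) ≠ 0 := fun h => by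
  have := congrFun h i
  simp [hi.ne'] at this

lemma injective_veronese : Function.Injective (veronese : Proj d → Fin d → Fin d → ℝ) := by
  intro ξ ξ' h
  obtain ⟨i, hi⟩ := exists_veronese_pos ξ
  have hi' : 0 < veronese ξ' i i := h ▸ hi
  rw [← mk_veronese_div ξ i hi (veronese_div_ne_zero ξ i hi),
    ← mk_veronese_div ξ' i hi' (veronese_div_ne_zero ξ' i hi')]
  simp only [h]

/-- The projection from the unit sphere of the sup norm. -/
noncomputable def sphereMk (v : Metric.sphere (0 : Fin d → ℝ) 1) : Proj d :=
  Projectivization.mk ℝ v.1 (ne_zero_of_mem_unit_sphere v)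

lemma continuous_sphereMk : Continuous (sphereMk : Metric.sphere (0 : Fin d → ℝ) 1 → Proj d) :=
  continuous_mk.comp (continuous_subtype_val.subtype_mk ne_zero_of_mem_unit_sphere)

lemma norm_inv_smul_mem {v : Fin d → ℝ} (hv : v ≠ 0) :
    ‖v‖⁻¹ • v ∈ Metric.sphere (0 : Fin d → ℝ) 1 := by
  rw [mem_sphere_zero_iff_norm, norm_smul, norm_inv, norm_norm,
    inv_mul_cancel₀ (norm_ne_zero_iff.2 hv)]

lemma sphereMk_normalize {v : Fin d → ℝ} (hv : v ≠ 0) :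
    sphereMk ⟨‖v‖⁻¹ • v, norm_inv_smul_mem hv⟩ = Projectivization.mk ℝ v hv := by
  unfold sphereMk
  rw [Projectivization.mk_eq_mk_iff']
  exact ⟨‖v‖⁻¹, rfl⟩

lemma surjective_sphereMk :
    Function.Surjective (sphereMk : Metric.sphere (0 : Fin d → ℝ) 1 → Proj d) := fun ξ =>
  ⟨_, (sphereMk_normalize ξ.rep_nonzero).trans ξ.mk_rep⟩

instance instCompactSpaceProj : CompactSpace (Proj d) :=
  ⟨by
    rw [← surjective_sphereMk.range_eq]
    exact isCompact_range continuous_sphereMk⟩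

/-- A continuous injection of a compact space into a Hausdorff space. Projective space inherits the
Hausdorff property and second countability through it. -/
lemma isClosedEmbedding_veronese :
    IsClosedEmbedding (veronese : Proj d → Fin d → Fin d → ℝ) :=
  continuous_veronese.isClosedEmbedding injective_veronese

instance instT2SpaceProj : T2Space (Proj d) := isClosedEmbedding_veronese.isEmbedding.t2Space

instance instSecondCountableTopologyProj : SecondCountableTopology (Proj d) :=
  isClosedEmbedding_veronese.isEmbedding.secondCountableTopology

/-- In Veronese coordinates the action is rational in the matrix and the point together, which gives
its joint continuity. -/
lemma veronese_smul (A : SL(d, ℝ)) (ξ : Proj d) (i j : Fin d) :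
    veronese (A • ξ) i j = (∑ k, ∑ l, A.1 i k * A.1 j l * veronese ξ k l) /
      ∑ m, ∑ k, ∑ l, A.1 m k * A.1 m l * veronese ξ k l := by
  have hs := (sum_sq_pos ξ.rep_nonzero).ne'
  have h1 : ∀ i j, ∑ k, ∑ l, A.1 i k * A.1 j l * veronese ξ k l =
      (A • ξ.rep) i * (A • ξ.rep) j / ∑ k, ξ.rep k ^ 2 := fun i j => by
    change _ = (∑ k, A.1 i k * ξ.rep k) * (∑ l, A.1 j l * ξ.rep l) / ∑ k, ξ.rep k ^ 2
    rw [Finset.sum_mul_sum, Finset.sum_div]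
    refine Finset.sum_congr rfl fun k _ => ?_
    rw [Finset.sum_div]
    refine Finset.sum_congr rfl fun l _ => ?_
    unfold veronese
    ring
  have hne : A • ξ.rep ≠ 0 := (smul_ne_zero_iff_ne A).mpr ξ.rep_nonzero
  have h2 : A • ξ = Projectivization.mk ℝ (A • ξ.rep) hne := by
    conv_lhs => rw [← ξ.mk_rep]
    rfl
  have hs' := (sum_sq_pos hne).ne'
  rw [h2, veronese_mk]
  simp only [h1, ← Finset.sum_div, ← pow_two]
  field_simp

lemma continuous_smul_prod : Continuous fun p : SL(d, ℝ) × Proj d => p.1 • p.2 := by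
  rw [isClosedEmbedding_veronese.isInducing.continuous_iff]
  refine continuous_pi fun i => continuous_pi fun j => ?_
  have hA : ∀ i j, Continuous fun p : SL(d, ℝ) × Proj d => p.1.1 i j := fun i j =>
    (continuous_apply_apply i j).comp
      (Matrix.SpecialLinearGroup.isClosedEmbedding_val.continuous.comp continuous_fst)
  have hv : ∀ i j, Continuous fun p : SL(d, ℝ) × Proj d => veronese p.2 i j := fun i j =>
    (continuous_apply_apply i j).comp (continuous_veronese.comp continuous_snd)
  have hsum : ∀ i j, Continuous fun p : SL(d, ℝ) × Proj d =>
      ∑ k, ∑ l, p.1.1 i k * p.1.1 j l * veronese p.2 k l := fun i j =>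
    continuous_finsetSum _ fun k _ => continuous_finsetSum _ fun l _ =>
      ((hA i k).mul (hA j l)).mul (hv k l)
  simp only [Function.comp_def, veronese_smul]
  refine (hsum i j).div (continuous_finsetSum _ fun m _ => hsum m m) fun p h => ?_
  obtain ⟨m, hm⟩ := exists_veronese_pos (p.1 • p.2)
  rw [veronese_smul, h, div_zero] at hm
  exact hm.false

lemma measurable_smul_prod : Measurable fun p : SL(d, ℝ) × Proj d => p.1 • p.2 :=
  continuous_smul_prod.measurable

lemma measurable_smul_left (A : SL(d, ℝ)) : Measurable fun ξ : Proj d => A • ξ :=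
  (continuous_smul_proj A).measurable

end ProjTopology

/-! ### Fine finite partitions of projective space. -/

section Cells

variable {d : ℕ}

/-- Two lines with unit representatives at distance at most `δ`. -/
def Near (δ : ℝ) (ξ ξ' : Proj d) : Prop :=
  ∃ v v' : Metric.sphere (0 : Fin d → ℝ) 1, sphereMk v = ξ ∧ sphereMk v' = ξ' ∧ dist v v' ≤ δ

/-- The index `i` is the first one of a largest diagonal Veronese coordinate. -/
def IsFirstMax (ξ : Proj d) (i : Fin d) : Prop :=
  (∀ j, veronese ξ j j ≤ veronese ξ i i) ∧ ∀ k < i, ¬ ∀ j, veronese ξ j j ≤ veronese ξ k k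

lemma exists_isFirstMax [NeZero d] (ξ : Proj d) : ∃ i, IsFirstMax ξ i := by
  have hne : {i : Fin d | ∀ j, veronese ξ j j ≤ veronese ξ i i}.Nonempty :=
    Finite.exists_max fun i => veronese ξ i i
  obtain ⟨i, hi, hmin⟩ := WellFounded.has_min (wellFounded_lt (α := Fin d)) _ hne
  exact ⟨i, hi, fun k hk h => hmin k h hk⟩

lemma IsFirstMax.unique {ξ : Proj d} {i k : Fin d} (hi : IsFirstMax ξ i) (hk : IsFirstMax ξ k) :
    i = k := by
  rcases lt_trichotomy i k with h | h | h
  · exact absurd hi.1 (hk.2 i h)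
  · exact h
  · exact absurd hk.1 (hi.2 k h)

lemma measurable_veronese (i j : Fin d) : Measurable fun ξ : Proj d => veronese ξ i j :=
  ((continuous_apply_apply i j).comp continuous_veronese).measurable

lemma measurableSet_isFirstMax (i : Fin d) : MeasurableSet {ξ : Proj d | IsFirstMax ξ i} := by
  have h : ∀ i, MeasurableSet {ξ : Proj d | ∀ j, veronese ξ j j ≤ veronese ξ i i} := fun i => by
    simp only [Set.ofPred_forall]
    exact .iInter fun j => measurableSet_le (measurable_veronese j j) (measurable_veronese i i)
  have heq : {ξ : Proj d | IsFirstMax ξ i} =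
      {ξ | ∀ j, veronese ξ j j ≤ veronese ξ i i} ∩
        ⋂ k, ⋂ _ : k < i, {ξ | ∀ j, veronese ξ j j ≤ veronese ξ k k}ᶜ := by
    ext ξ
    simp [IsFirstMax]
  rw [heq]
  exact (h i).inter (.iInter fun k => .iInter fun _ => (h k).compl)

end Cells

section Partition

variable {d : ℕ}

lemma abs_veronese_div_le {ξ : Proj d} {i : Fin d} (hi : IsFirstMax ξ i) (j : Fin d) :
    |veronese ξ i j / veronese ξ i i| ≤ 1 := by
  rw [abs_div, abs_of_nonneg (veronese_self_nonneg ξ i)]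
  refine div_le_one_of_le₀ (abs_le_of_sq_le_sq ?_ (veronese_self_nonneg ξ i))
    (veronese_self_nonneg ξ i)
  rw [veronese_self_mul_self, pow_two]
  exact mul_le_mul_of_nonneg_left (hi.1 j) (veronese_self_nonneg ξ i)

lemma IsFirstMax.pos {ξ : Proj d} {i : Fin d} (hi : IsFirstMax ξ i) : 0 < veronese ξ i i := by
  obtain ⟨j, hj⟩ := exists_veronese_pos ξ
  exact hj.trans_le (hi.1 j)

lemma IsFirstMax.mem_sphere {ξ : Proj d} {i : Fin d} (hi : IsFirstMax ξ i) :
    (fun j => veronese ξ i j / veronese ξ i i) ∈ Metric.sphere (0 : Fin d → ℝ) 1 := by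
  rw [mem_sphere_zero_iff_norm]
  refine le_antisymm ((pi_norm_le_iff_of_nonneg zero_le_one).2 (abs_veronese_div_le hi)) ?_
  have := norm_le_pi_norm (fun j => veronese ξ i j / veronese ξ i i) i
  simpa [div_self hi.pos.ne'] using this

lemma IsFirstMax.sphereMk_eq {ξ : Proj d} {i : Fin d} (hi : IsFirstMax ξ i) :
    sphereMk ⟨_, hi.mem_sphere⟩ = ξ :=
  mk_veronese_div ξ i hi.pos _

/-- Projective space has partitions into `O(m^(d-1))` measurable cells of diameter `O(1/m)`. -/
lemma exists_partition (d : ℕ) [NeZero d] (m : ℕ) (hm : 0 < m) :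
    ∃ (ι : Type) (_ : Fintype ι) (ℓ : Proj d → ι), (∀ c, MeasurableSet (ℓ ⁻¹' {c})) ∧
      Fintype.card ι ≤ d * (2 * m + 1) ^ (d - 1) ∧
      ∀ ξ ξ', ℓ ξ = ℓ ξ' → Near (1 / (m : ℝ)) ξ ξ' := by
  classical
  have hm' : (0 : ℝ) < m := by exact_mod_cast hm
  choose i hi using exists_isFirstMax (d := d)
  -- In the chart of the largest coordinate, normalized to one, that coordinate rounds to exactly
  -- `m` and only `d - 1` coordinates are free. This is the origin of the factor `d - 1` in the
  -- entropy bound.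
  let R : Fin d → Fin d → Finset ℤ := fun k j => if j = k then {(m : ℤ)} else Finset.Icc (-m) m
  let T : Finset (Fin d × (Fin d → ℤ)) := (Finset.univ : Finset (Fin d)).biUnion fun k =>
    {k} ×ˢ Fintype.piFinset (R k)
  let f : Proj d → Fin d × (Fin d → ℤ) := fun ξ =>
    (i ξ, fun j => ⌊m * (veronese ξ (i ξ) j / veronese ξ (i ξ) (i ξ))⌋)
  have hf : ∀ ξ, f ξ ∈ T := fun ξ => by
    simp only [T, Finset.mem_biUnion, Finset.mem_univ, true_and, Finset.mem_product,
      Finset.mem_singleton, Fintype.mem_piFinset]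
    refine ⟨i ξ, rfl, fun j => ?_⟩
    simp only [R]
    split_ifs with hj
    · simp [f, hj, div_self (hi ξ).pos.ne']
    · have h := abs_le.1 (abs_veronese_div_le (hi ξ) j)
      rw [Finset.mem_Icc]
      constructor
      · rw [Int.le_floor]
        push_cast
        nlinarith
      · rw [← Int.cast_le (R := ℝ)]
        refine (Int.floor_le _).trans ?_
        push_cast
        nlinarith
  refine ⟨T, inferInstance, fun ξ => ⟨f ξ, hf ξ⟩, ?_, ?_, ?_⟩
  · rintro ⟨⟨k, z⟩, hc⟩
    have heq : (fun ξ => (⟨f ξ, hf ξ⟩ : T)) ⁻¹' {⟨(k, z), hc⟩} = {ξ | IsFirstMax ξ k} ∩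
        ⋂ j, {ξ | ⌊m * (veronese ξ k j / veronese ξ k k)⌋ = z j} := by
      ext ξ
      simp only [Set.mem_preimage, Set.mem_singleton_iff, Subtype.mk.injEq, f, Prod.mk.injEq,
        Set.mem_inter_iff, Set.mem_ofPred_eq, Set.mem_iInter]
      constructor
      · rintro ⟨rfl, h⟩
        exact ⟨hi ξ, fun j => congrFun h j⟩
      · rintro ⟨hk, h⟩
        obtain rfl := (hi ξ).unique hk
        exact ⟨rfl, funext h⟩
    rw [heq]
    refine (measurableSet_isFirstMax k).inter (.iInter fun j => ?_)
    exact (Int.measurable_floor.comp (((measurable_veronese k j).div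
      (measurable_veronese k k)).const_mul (m : ℝ))) (measurableSet_singleton (z j))
  · rw [Fintype.card_coe]
    refine Finset.card_biUnion_le.trans ?_
    have hR : ∀ k : Fin d, (({k} : Finset (Fin d)) ×ˢ Fintype.piFinset (R k)).card =
        (2 * m + 1) ^ (d - 1) := fun k => by
      rw [Finset.card_product, Finset.card_singleton, one_mul, Fintype.card_piFinset,
        ← Finset.mul_prod_erase _ _ (Finset.mem_univ k)]
      have h1 : ∀ j ∈ Finset.univ.erase k, (R k j).card = 2 * m + 1 := fun j hj => by
        simp only [R, if_neg (Finset.ne_of_mem_erase hj), Int.card_Icc]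
        omega
      rw [Finset.prod_congr rfl h1, Finset.prod_const, Finset.card_erase_of_mem
        (Finset.mem_univ k), Finset.card_univ, Fintype.card_fin]
      simp [R]
    rw [Finset.sum_congr rfl fun k _ => hR k]
    simp
  · intro ξ ξ' h
    have h' : f ξ = f ξ' := congrArg Subtype.val h
    obtain ⟨h1, h2⟩ := Prod.mk.injEq _ _ _ _ ▸ h'
    have hi' : IsFirstMax ξ' (i ξ) := h1 ▸ hi ξ'
    refine ⟨⟨_, (hi ξ).mem_sphere⟩, ⟨_, hi'.mem_sphere⟩, (hi ξ).sphereMk_eq, hi'.sphereMk_eq, ?_⟩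
    rw [Subtype.dist_eq, dist_pi_le_iff (by positivity)]
    intro j
    have h3 : ⌊m * (veronese ξ (i ξ) j / veronese ξ (i ξ) (i ξ))⌋ =
        ⌊m * (veronese ξ' (i ξ) j / veronese ξ' (i ξ) (i ξ))⌋ := by
      have := congrFun h2 j
      simp only [← h1] at this
      exact this
    have h4 := Int.abs_sub_lt_one_of_floor_eq_floor h3
    rw [← mul_sub, abs_mul, abs_of_pos hm'] at h4
    rw [Real.dist_eq, le_div_iff₀ hm']
    linarith

/-- Pull unit representatives back by `B⁻¹` and renormalize. Their difference is at most `d * opNorm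
B⁻¹ * δ`, their lengths are at least the inverse of `d * opNorm B`, and renormalizing costs the
factor 2. -/
lemma Near.of_smul {δ : ℝ} {B : SL(d, ℝ)} {ξ ξ' : Proj d} (h : Near δ (B • ξ) (B • ξ')) :
    Near (2 * (d * opNorm B) * (d * opNorm B⁻¹) * δ) ξ ξ' := by
  obtain ⟨w, w', hw, hw', hd⟩ := h
  have hne : ∀ w : Metric.sphere (0 : Fin d → ℝ) 1, B⁻¹ • w.1 ≠ 0 := fun w =>
    (smul_ne_zero_iff_ne B⁻¹).mpr (ne_zero_of_mem_unit_sphere w)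
  have hmk : ∀ (w : Metric.sphere (0 : Fin d → ℝ) 1) (ξ : Proj d), sphereMk w = B • ξ →
      sphereMk ⟨_, norm_inv_smul_mem (hne w)⟩ = ξ := fun w ξ hw => by
    rw [sphereMk_normalize, ← inv_smul_smul B ξ, ← hw]
    rfl
  refine ⟨_, _, hmk w ξ hw, hmk w' ξ' hw', ?_⟩
  set u := B⁻¹ • w.1
  set u' := B⁻¹ • w'.1
  have hu0 : 0 < ‖u‖ := norm_pos_iff.2 (hne w)
  have hu0' : 0 < ‖u'‖ := norm_pos_iff.2 (hne w')
  have hu : 1 ≤ d * opNorm B * ‖u‖ := by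
    have h1 := norm_mulVec_le B u
    rwa [smul_inv_smul, mem_sphere_zero_iff_norm.1 w.2] at h1
  have huu : ‖u - u'‖ ≤ d * opNorm B⁻¹ * δ := by
    have h1 := norm_mulVec_le B⁻¹ (w.1 - w'.1)
    rw [smul_sub] at h1
    refine h1.trans (mul_le_mul_of_nonneg_left ?_ (mul_nonneg d.cast_nonneg (opNorm_nonneg _)))
    rwa [← dist_eq_norm, ← Subtype.dist_eq]
  rw [Subtype.dist_eq, dist_eq_norm]
  have h2 : ‖u‖⁻¹ • u - ‖u'‖⁻¹ • u' =
      ‖u‖⁻¹ • ((u - u') + ((‖u'‖ - ‖u‖) * ‖u'‖⁻¹) • u') := by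
    rw [smul_add, smul_sub, smul_smul, ← mul_assoc, mul_sub, inv_mul_cancel₀ hu0.ne', sub_mul,
      mul_assoc, mul_inv_cancel₀ hu0'.ne', sub_smul]
    simp
  calc ‖‖u‖⁻¹ • u - ‖u'‖⁻¹ • u'‖
      ≤ ‖u‖⁻¹ * (‖u - u'‖ + ‖u - u'‖) := by
        rw [h2, norm_smul, norm_inv, norm_norm]
        refine mul_le_mul_of_nonneg_left ((norm_add_le _ _).trans (add_le_add_right ?_ _))
          (inv_nonneg.2 hu0.le)
        rw [norm_smul, norm_mul, norm_inv, norm_norm, mul_assoc, inv_mul_cancel₀ hu0'.ne',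
          mul_one, Real.norm_eq_abs, norm_sub_rev]
        exact abs_norm_sub_norm_le _ _
    _ ≤ (d * opNorm B) * (d * opNorm B⁻¹ * δ + d * opNorm B⁻¹ * δ) := by
        refine mul_le_mul ?_ (add_le_add huu huu) (by positivity)
          (mul_nonneg d.cast_nonneg (opNorm_nonneg _))
        rw [inv_le_iff_one_le_mul₀ hu0]
        exact hu
    _ = _ := by ring

lemma exists_near_dist_le (f : C(Proj d, ℝ)) {η : ℝ} (hη : 0 < η) :
    ∃ r > 0, ∀ ξ ξ', Near r ξ ξ' → |f ξ - f ξ'| ≤ η := by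
  have huc : UniformContinuous fun v : Metric.sphere (0 : Fin d → ℝ) 1 => f (sphereMk v) :=
    CompactSpace.uniformContinuous_of_continuous (f.continuous.comp continuous_sphereMk)
  obtain ⟨r, hr, h⟩ := Metric.uniformContinuous_iff.1 huc η hη
  refine ⟨r / 2, by positivity, ?_⟩
  rintro ξ ξ' ⟨v, v', rfl, rfl, hd⟩
  exact (h (hd.trans_lt (by linarith))).le

lemma Near.mono {δ δ' : ℝ} (h : δ ≤ δ') {ξ ξ' : Proj d} (hn : Near δ ξ ξ') : Near δ' ξ ξ' := by
  obtain ⟨v, v', h1, h2, h3⟩ := hn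
  exact ⟨v, v', h1, h2, h3.trans h⟩

end Partition

/-! ### Divergence as a supremum over test functions. -/

section DonskerVaradhan

open InformationTheory

variable {X : Type*} [MeasurableSpace X]

/-- The Donsker-Varadhan functional. -/
noncomputable def dv (α β : Measure X) (f : X → ℝ) : ℝ :=
  ∫ x, f x ∂α - Real.log (∫ x, Real.exp (f x) ∂β)

lemma integrable_of_abs_le {α : Measure X} [IsFiniteMeasure α] {f : X → ℝ} (hf : Measurable f)
    {M : ℝ} (hM : ∀ x, |f x| ≤ M) : Integrable f α :=
  (integrable_const M).mono' hf.aestronglyMeasurable (ae_of_all _ hM)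

lemma integrable_exp_of_abs_le {α : Measure X} [IsFiniteMeasure α] {f : X → ℝ}
    (hf : Measurable f) {M : ℝ} (hM : ∀ x, |f x| ≤ M) :
    Integrable (fun x => Real.exp (f x)) α :=
  (integrable_const (Real.exp M)).mono' (Real.measurable_exp.comp hf).aestronglyMeasurable
    (ae_of_all _ fun x => by
      rw [Real.norm_of_nonneg (Real.exp_pos _).le]
      exact Real.exp_le_exp.2 (abs_le.1 (hM x)).2)

lemma integral_exp_pos_of_abs_le {α : Measure X} [IsProbabilityMeasure α] {f : X → ℝ}
    (hf : Measurable f) {M : ℝ} (hM : ∀ x, |f x| ≤ M) : 0 < ∫ x, Real.exp (f x) ∂α :=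
  integral_exp_pos (integrable_exp_of_abs_le hf hM)

lemma dv_le_dv_add {α β : Measure X} [IsProbabilityMeasure α] [IsProbabilityMeasure β]
    {f g : X → ℝ} (hf : Measurable f) (hg : Measurable g) {M N ε : ℝ} (hM : ∀ x, |f x| ≤ M)
    (hN : ∀ x, |g x| ≤ N) (h : ∀ x, |f x - g x| ≤ ε) : dv α β f ≤ dv α β g + 2 * ε := by
  have h1 : ∫ x, f x ∂α ≤ ∫ x, g x ∂α + ε := by
    calc ∫ x, f x ∂α ≤ ∫ x, (g x + ε) ∂α := integral_mono (integrable_of_abs_le hf hM)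
          ((integrable_of_abs_le hg hN).add (integrable_const ε)) fun x => by
            have := (abs_le.1 (h x)).2
            simp only
            linarith
      _ = _ := by
        rw [integral_add (integrable_of_abs_le hg hN) (integrable_const ε)]
        simp
  have h2 : Real.log (∫ x, Real.exp (g x) ∂β) ≤ Real.log (∫ x, Real.exp (f x) ∂β) + ε := by
    have hf0 := integral_exp_pos_of_abs_le (α := β) hf hM
    rw [← Real.log_exp ε, ← Real.log_mul hf0.ne' (Real.exp_pos _).ne', ← integral_mul_const]
    refine Real.log_le_log (integral_exp_pos_of_abs_le hg hN) (integral_mono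
      (integrable_exp_of_abs_le hg hN) ((integrable_exp_of_abs_le hf hM).mul_const _) fun x => ?_)
    simp only
    rw [← Real.exp_add, Real.exp_le_exp]
    have := (abs_le.1 (h x)).1
    linarith
  unfold dv
  linarith

section Truncation

/-- A truncation of the logarithm which is bounded by `n` in absolute value. -/
noncomputable def truncLog (n : ℕ) (x : ℝ) : ℝ :=
  if x = 0 then -(n : ℝ) else max (-(n : ℝ)) (min n (Real.log x))

lemma measurable_truncLog (n : ℕ) : Measurable (truncLog n) :=
  Measurable.ite (measurableSet_singleton 0) measurable_const
    (measurable_const.max (measurable_const.min Real.measurable_log))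

lemma abs_truncLog_le (n : ℕ) (x : ℝ) : |truncLog n x| ≤ n := by
  have hn : (0 : ℝ) ≤ n := n.cast_nonneg
  unfold truncLog
  split_ifs
  · simp
  · exact abs_le.2 ⟨le_max_left _ _, max_le (by linarith) (min_le_left _ _)⟩

/-- The concave function t ↦ xt + 1 - exp t vanishes at 0 and is nonnegative between 0 and log x,
where the truncation lies; at x = 0 this reads 1 - exp(-n) ≥ 0. The sign allows the use of Fatou's
lemma. -/
lemma nonneg_truncLog (n : ℕ) {x : ℝ} (hx : 0 ≤ x) :
    0 ≤ x * truncLog n x + 1 - Real.exp (truncLog n x) := by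
  have hn : (0 : ℝ) ≤ n := n.cast_nonneg
  rcases hx.eq_or_lt with rfl | hx
  · simp [truncLog]
  set t := truncLog n x with ht
  have key : Real.exp t - 1 ≤ Real.exp t * t := by
    have h1 := Real.add_one_le_exp (-t)
    have h2 : Real.exp t * Real.exp (-t) = 1 := by rw [← Real.exp_add]; simp
    nlinarith [Real.exp_pos t]
  have htx : t = max (-(n : ℝ)) (min n (Real.log x)) := by rw [ht, truncLog, if_neg hx.ne']
  rcases le_total 0 t with h0 | h0
  · have : t ≤ Real.log x ∨ t = 0 := by
      rcases le_total 0 (Real.log x) with hl | hl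
      · left
        rw [htx]
        exact max_le (by linarith) (min_le_right _ _)
      · right
        refine le_antisymm ?_ h0
        rw [htx]
        exact max_le (by linarith) ((min_le_right _ _).trans hl)
    rcases this with h | h
    · have := (Real.le_log_iff_exp_le hx).1 h
      nlinarith
    · simp [h]
  · have : Real.log x ≤ t ∨ t = 0 := by
      rcases le_total 0 (Real.log x) with hl | hl
      · right
        refine le_antisymm h0 ?_
        rw [htx]
        exact le_max_of_le_right (le_min hn hl)
      · left
        rw [htx]
        exact le_max_of_le_right (le_min (hl.trans hn) le_rfl)
    rcases this with h | h
    · have := (Real.log_le_iff_le_exp hx).1 h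
      nlinarith
    · simp [h]

lemma tendsto_truncLog {x : ℝ} (hx : 0 ≤ x) :
    Tendsto (fun n => x * truncLog n x + 1 - Real.exp (truncLog n x)) atTop (𝓝 (klFun x)) := by
  rcases hx.eq_or_lt with rfl | hx
  · have h : Tendsto (fun n : ℕ => 1 - Real.exp (-(n : ℝ))) atTop (𝓝 (1 - 0)) :=
      tendsto_const_nhds.sub (Real.tendsto_exp_neg_atTop_nhds_zero.comp
        tendsto_natCast_atTop_atTop)
    simpa [truncLog, klFun] using h
  · refine tendsto_const_nhds.congr' ?_
    filter_upwards [eventually_ge_atTop ⌈|Real.log x|⌉₊] with n hn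
    have h1 : |Real.log x| ≤ n := Nat.ceil_le.1 hn
    have h2 : truncLog n x = Real.log x := by
      rw [truncLog, if_neg hx.ne', min_eq_right (abs_le.1 h1).2, max_eq_right (abs_le.1 h1).1]
    rw [h2, Real.exp_log hx, klFun]

end Truncation

/-- The Donsker-Varadhan bound from bounded measurable test functions. -/
lemma klDiv_le_of_forall_measurable {α β : Measure X} [IsProbabilityMeasure α]
    [IsProbabilityMeasure β] {K : ℝ}
    (h : ∀ (g : X → ℝ) (M : ℝ), Measurable g → (∀ x, |g x| ≤ M) → dv α β g ≤ K) :
    klDiv α β ≤ ENNReal.ofReal K := by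
  have hac : α ≪ β := by
    refine Measure.AbsolutelyContinuous.mk fun s hs hβs => ?_
    by_contra hαs
    have hpos : 0 < α.real s := by
      rw [measureReal_def]
      exact ENNReal.toReal_pos hαs (measure_ne_top _ _)
    -- On a `β`-null set `s` the test function with value `t` on `s` has functional t α(s) = |K| +
    -- 1, which exceeds `K`.
    set t : ℝ := (|K| + 1) / α.real s
    have hg := h (s.indicator fun _ => t) |t| (measurable_const.indicator hs) fun x => by
      by_cases hx : x ∈ s <;> simp [hx]
    have h1 : ∫ x, Real.exp (s.indicator (fun _ => t) x) ∂β = 1 := by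
      have hae : (fun x => Real.exp (s.indicator (fun _ => t) x)) =ᵐ[β] fun _ => 1 := by
        filter_upwards [measure_eq_zero_iff_ae_notMem.1 hβs] with x hx
        simp [hx]
      rw [integral_congr_ae hae]
      simp
    rw [dv, h1, Real.log_one, sub_zero, integral_indicator_const _ hs, smul_eq_mul,
      mul_div_cancel₀ _ hpos.ne'] at hg
    linarith [le_abs_self K]
  rw [klDiv_eq_lintegral_klFun_of_ac hac]
  set ρ : X → ℝ := fun x => (α.rnDeriv β x).toReal with hρ
  have hρm : Measurable ρ := (Measure.measurable_rnDeriv α β).ennreal_toReal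
  have hρ0 : ∀ x, 0 ≤ ρ x := fun x => ENNReal.toReal_nonneg
  let H : ℕ → X → ℝ := fun n x =>
    ρ x * truncLog n (ρ x) + 1 - Real.exp (truncLog n (ρ x))
  have hHm : ∀ n, Measurable (H n) := fun n =>
    ((hρm.mul ((measurable_truncLog n).comp hρm)).add_const 1).sub
      (Real.measurable_exp.comp ((measurable_truncLog n).comp hρm))
  have hgm : ∀ n, Measurable fun x => truncLog n (ρ x) := fun n =>
    (measurable_truncLog n).comp hρm
  have hgb : ∀ n x, |truncLog n (ρ x)| ≤ n := fun n x => abs_truncLog_le n _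
  have hint1 : ∀ n, Integrable (fun x => ρ x * truncLog n (ρ x)) β := fun n =>
    Measure.integrable_toReal_rnDeriv.mul_bdd (c := (n : ℝ)) (hgm n).aestronglyMeasurable
      (ae_of_all _ (hgb n))
  have hHint : ∀ n, Integrable (H n) β := fun n =>
    ((hint1 n).add (integrable_const 1)).sub (integrable_exp_of_abs_le (hgm n) (hgb n))
  have hval : ∀ n, ∫ x, H n x ∂β ≤ K := fun n => by
    have e1 : ∫ x, H n x ∂β = ∫ x, truncLog n (ρ x) ∂α + 1
        - ∫ x, Real.exp (truncLog n (ρ x)) ∂β := by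
      have := integral_sub ((hint1 n).add (integrable_const (1 : ℝ)))
        (integrable_exp_of_abs_le (hgm n) (hgb n))
      simp only [Pi.add_apply] at this
      simp only [H]
      rw [this, integral_add (hint1 n) (integrable_const (1 : ℝ)),
        ← integral_rnDeriv_smul hac (f := fun x => truncLog n (ρ x))]
      simp [hρ]
    -- By log y ≤ y - 1 the integral of `H n` is at most the Donsker-Varadhan functional of the
    -- truncated log-density.
    have e2 := Real.log_le_sub_one_of_pos (integral_exp_pos_of_abs_le (α := β) (hgm n) (hgb n))
    have e3 := h _ _ (hgm n) (hgb n)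
    unfold dv at e3
    linarith
  have hlim : ∀ x, ENNReal.ofReal (klFun (ρ x)) =
      liminf (fun n => ENNReal.ofReal (H n x)) atTop := fun x =>
    ((ENNReal.continuous_ofReal.tendsto _).comp (tendsto_truncLog (hρ0 x))).liminf_eq.symm
  calc ∫⁻ x, ENNReal.ofReal (klFun (ρ x)) ∂β
      = ∫⁻ x, liminf (fun n => ENNReal.ofReal (H n x)) atTop ∂β := lintegral_congr hlim
    _ ≤ liminf (fun n => ∫⁻ x, ENNReal.ofReal (H n x) ∂β) atTop :=
        lintegral_liminf_le fun n => (hHm n).ennreal_ofReal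
    _ ≤ liminf (fun _ : ℕ => ENNReal.ofReal K) atTop := by
        refine liminf_le_liminf (Eventually.of_forall fun n => ?_)
        rw [← ofReal_integral_eq_lintegral_ofReal (hHint n)
          (ae_of_all _ fun x => nonneg_truncLog n (hρ0 x))]
        exact ENNReal.ofReal_le_ofReal (hval n)
    _ = ENNReal.ofReal K := liminf_const _

variable [TopologicalSpace X] [CompactSpace X] [T2Space X] [SecondCountableTopology X]
  [BorelSpace X]

/-- The **Donsker-Varadhan** bound from continuous test functions. -/
lemma klDiv_le_of_forall_continuous {α β : Measure X} [IsProbabilityMeasure α]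
    [IsProbabilityMeasure β] {K : ℝ} (h : ∀ f : C(X, ℝ), dv α β f ≤ K) :
    klDiv α β ≤ ENNReal.ofReal K := by
  refine klDiv_le_of_forall_measurable fun g M hg hM => ?_
  have hM0 : 0 ≤ M := by
    have : Nonempty X := nonempty_of_isProbabilityMeasure α
    exact (abs_nonneg _).trans (hM (Classical.arbitrary X))
  have happrox : ∀ ε : ℝ, 0 < ε → ∫ x, g x ∂α ≤
      K + ε + Real.log (∫ x, Real.exp (g x) ∂β + Real.exp M * ε) := by
    intro ε hε
    -- Approximation in L¹ of `α + β` controls both integrals at once. Clamping to [-M, M] does not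
    -- increase the error and bounds the slope of the exponential by exp M.
    obtain ⟨f₀, hf₀, hf₀i⟩ := Integrable.exists_boundedContinuous_integral_sub_le
      (integrable_of_abs_le (α := α + β) hg hM) hε
    let f : C(X, ℝ) := ⟨fun x => max (min (f₀ x) M) (-M), by fun_prop⟩
    have hfM : ∀ x, |f x| ≤ M := fun x =>
      abs_le.2 ⟨le_max_right _ _, max_le (min_le_right _ _) (by linarith)⟩
    have hfg : ∀ x, |g x - f x| ≤ ‖g x - f₀ x‖ := fun x => by
      have h1 := abs_le.1 (hM x)
      have h2 : g x = max (min (g x) M) (-M) := by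
        rw [min_eq_left h1.2, max_eq_left h1.1]
      change |g x - max (min (f₀ x) M) (-M)| ≤ _
      conv_lhs => rw [h2]
      exact (abs_sup_sub_sup_le_abs _ _ _).trans (abs_inf_sub_inf_le_abs _ _ _)
    have hfm : Measurable f := f.continuous.measurable
    have hdm : Measurable fun x => |g x - f x| := (hg.sub hfm).abs
    have hdb : ∀ x, |(fun x => |g x - f x|) x| ≤ 2 * M := fun x => by
      have h1 := abs_le.1 (hM x)
      have h2 := abs_le.1 (hfM x)
      simp only [abs_abs]
      exact abs_le.2 ⟨by linarith, by linarith⟩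
    have hdint : ∫ x, |g x - f x| ∂(α + β) ≤ ε :=
      (integral_mono (integrable_of_abs_le hdm hdb)
        ((integrable_of_abs_le hg hM).sub hf₀i).norm hfg).trans hf₀
    rw [integral_add_measure (integrable_of_abs_le hdm hdb) (integrable_of_abs_le hdm hdb)]
      at hdint
    have hα0 : 0 ≤ ∫ x, |g x - f x| ∂α := integral_nonneg fun _ => abs_nonneg _
    have hβ0 : 0 ≤ ∫ x, |g x - f x| ∂β := integral_nonneg fun _ => abs_nonneg _
    have e1 : ∫ x, g x ∂α ≤ ∫ x, f x ∂α + ε := by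
      have : ∫ x, g x ∂α ≤ ∫ x, (f x + |g x - f x|) ∂α :=
        integral_mono (integrable_of_abs_le hg hM)
          ((integrable_of_abs_le hfm hfM).add (integrable_of_abs_le hdm hdb)) fun x => by
            simp only
            linarith [le_abs_self (g x - f x)]
      rw [integral_add (integrable_of_abs_le hfm hfM) (integrable_of_abs_le hdm hdb)] at this
      linarith
    have e2 : ∫ x, Real.exp (f x) ∂β ≤ ∫ x, Real.exp (g x) ∂β + Real.exp M * ε := by
      have : ∫ x, Real.exp (f x) ∂β ≤ ∫ x, (Real.exp (g x) + Real.exp M * |g x - f x|) ∂β :=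
        integral_mono (integrable_exp_of_abs_le hfm hfM)
          ((integrable_exp_of_abs_le hg hM).add
            ((integrable_of_abs_le hdm hdb).const_mul _)) fun x => by
            simp only
            have k1 := Real.add_one_le_exp (g x - f x)
            have k2 : Real.exp (f x) * Real.exp (g x - f x) = Real.exp (g x) := by
              rw [← Real.exp_add]; congr 1; ring
            have k3 : Real.exp (f x) ≤ Real.exp M := Real.exp_le_exp.2 (abs_le.1 (hfM x)).2
            have k4 := neg_abs_le (g x - f x)
            nlinarith [Real.exp_pos (f x), abs_nonneg (g x - f x)]
      rw [integral_add (integrable_exp_of_abs_le hg hM)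
        ((integrable_of_abs_le hdm hdb).const_mul _), integral_const_mul] at this
      nlinarith [Real.exp_pos M]
    have e3 := h f
    unfold dv at e3
    have e4 := Real.log_le_log (integral_exp_pos_of_abs_le (α := β) hfm hfM) e2
    linarith
  have hpos := integral_exp_pos_of_abs_le (α := β) hg hM
  have hlim : Tendsto (fun ε : ℝ =>
      K + ε + Real.log (∫ x, Real.exp (g x) ∂β + Real.exp M * ε)) (𝓝[>] 0)
      (𝓝 (K + 0 + Real.log (∫ x, Real.exp (g x) ∂β + Real.exp M * 0))) := by
    refine tendsto_nhdsWithin_of_tendsto_nhds (ContinuousAt.tendsto (x := (0 : ℝ)) ?_)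
    exact (continuousAt_const.add continuousAt_id).add (ContinuousAt.log
      (continuousAt_const.add (continuousAt_const.mul continuousAt_id)) (by simpa using hpos.ne'))
  have := ge_of_tendsto hlim (by
    filter_upwards [self_mem_nhdsWithin] with ε hε using happrox ε hε)
  simp only [add_zero, mul_zero] at this
  unfold dv
  linarith

/-- The maximum of the first Donsker-Varadhan functionals of a sequence, and zero. -/
noncomputable def maxDV (D : ℕ → C(X, ℝ)) (α β : Measure X) : ℕ → ℝ
  | 0 => 0
  | N + 1 => max (maxDV D α β N) (dv α β (D N))

lemma maxDV_nonneg (D : ℕ → C(X, ℝ)) (α β : Measure X) (N : ℕ) : 0 ≤ maxDV D α β N := by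
  induction N with
  | zero => exact le_rfl
  | succ N ih => exact ih.trans (le_max_left _ _)

lemma monotone_maxDV (D : ℕ → C(X, ℝ)) (α β : Measure X) : Monotone (maxDV D α β) :=
  monotone_nat_of_le_succ fun _ => le_max_left _ _

/-- The functional changes by at most twice the uniform distance of the test functions, so a dense
sequence suffices. -/
lemma klDiv_le_iSup_maxDV {D : ℕ → C(X, ℝ)} (hD : DenseRange D) (α β : Measure X)
    [IsProbabilityMeasure α] [IsProbabilityMeasure β] :
    klDiv α β ≤ ⨆ N, ENNReal.ofReal (maxDV D α β N) := by
  set S := ⨆ N, ENNReal.ofReal (maxDV D α β N) with hS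
  rcases eq_or_ne S ∞ with htop | htop
  · rw [htop]; exact le_top
  rw [← ENNReal.ofReal_toReal htop]
  have hi : ∀ i, dv α β (D i) ≤ S.toReal := fun i => by
    refine (le_max_right (maxDV D α β i) _).trans ?_
    rw [← ENNReal.ofReal_le_iff_le_toReal htop]
    exact le_iSup (fun N => ENNReal.ofReal (maxDV D α β N)) (i + 1)
  refine klDiv_le_of_forall_continuous fun f => le_of_forall_pos_le_add fun ε hε => ?_
  obtain ⟨i, hfi⟩ := hD.exists_dist_lt f (half_pos hε)
  have hle := dv_le_dv_add (α := α) (β := β) f.continuous.measurable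
    (D i).continuous.measurable (fun x => f.norm_coe_le_norm x)
    (fun x => (D i).norm_coe_le_norm x) (ε := ε / 2) fun x => by
      have := ContinuousMap.dist_apply_le_dist (f := f) (g := D i) x
      rw [Real.dist_eq] at this
      linarith
  linarith [hi i]

end DonskerVaradhan

/-! ### Divergence relative to a finite partition. -/

section Gibbs

/-- The Gibbs variational inequality on a finite set. -/
lemma sum_mul_sub_log_sum_le {ι : Type*} [Fintype ι] {p q : ι → ℝ} (t : ι → ℝ)
    (hp : ∀ c, 0 ≤ p c) (hq : ∀ c, 0 ≤ q c) (hp1 : ∑ c, p c = 1) (hq1 : ∑ c, q c = 1)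
    (hpq : ∀ c, q c = 0 → p c = 0) :
    ∑ c, p c * t c - Real.log (∑ c, q c * Real.exp (t c)) ≤
      ∑ c, (p c * Real.log (p c) - p c * Real.log (q c)) := by
  set s := ∑ c, q c * Real.exp (t c) with hs
  have hs0 : 0 < s := by
    obtain ⟨c, -, hc⟩ : ∃ c ∈ Finset.univ, 0 < q c := by
      by_contra! h
      have : ∑ c, q c ≤ 0 := Finset.sum_nonpos h
      linarith
    exact Finset.sum_pos' (fun c _ => mul_nonneg (hq c) (Real.exp_pos _).le)
      ⟨c, Finset.mem_univ c, mul_pos hc (Real.exp_pos _)⟩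
  -- This is log y ≤ y - 1 at y = q exp(t) / (s p), multiplied by p; the right sides sum to 1 - 1 =
  -- 0.
  have hterm : ∀ c, p c * t c - p c * Real.log s - (p c * Real.log (p c) - p c * Real.log (q c))
      ≤ q c * Real.exp (t c) / s - p c := by
    intro c
    rcases (hp c).eq_or_lt with h0 | h0
    · rw [← h0]
      simp only [zero_mul, sub_zero]
      exact div_nonneg (mul_nonneg (hq c) (Real.exp_pos _).le) hs0.le
    · have hq0 : 0 < q c := (hq c).lt_of_ne fun h => h0.ne' (hpq c h.symm)
      have h1 := Real.log_le_sub_one_of_pos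
        (div_pos (div_pos (mul_pos hq0 (Real.exp_pos (t c))) hs0) h0)
      rw [Real.log_div (by positivity) h0.ne', Real.log_div (by positivity) hs0.ne',
        Real.log_mul hq0.ne' (Real.exp_pos _).ne', Real.log_exp] at h1
      have h2 := mul_le_mul_of_nonneg_left h1 h0.le
      rw [mul_sub (p c) (_ / p c) 1, mul_div_cancel₀ _ h0.ne'] at h2
      linarith
  have hsum := Finset.sum_le_sum fun c (_ : c ∈ Finset.univ) => hterm c
  simp only [Finset.sum_sub_distrib] at hsum ⊢
  rw [← Finset.sum_mul, ← Finset.sum_div, ← hs, div_self hs0.ne', hp1] at hsum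
  linarith

end Gibbs

section CellSum

variable {X : Type*} [MeasurableSpace X] {ι : Type*} [Fintype ι] {ℓ : X → ι}

lemma comp_eq_sum_indicator (φ : ι → ℝ) :
    (fun x => φ (ℓ x)) = fun x => ∑ c, (ℓ ⁻¹' {c}).indicator (fun _ => φ c) x := by
  classical
  funext x
  rw [Finset.sum_eq_single (ℓ x)]
  · simp
  · intro c _ hc
    have hx : x ∉ ℓ ⁻¹' {c} := fun h => hc (Set.mem_singleton_iff.1 h).symm
    exact Set.indicator_of_notMem hx _
  · simp

lemma integral_comp_label (hℓ : ∀ c, MeasurableSet (ℓ ⁻¹' {c})) (α : Measure X)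
    [IsFiniteMeasure α] (φ : ι → ℝ) :
    ∫ x, φ (ℓ x) ∂α = ∑ c, α.real (ℓ ⁻¹' {c}) * φ c := by
  rw [comp_eq_sum_indicator, integral_finsetSum _ fun c _ =>
    (integrable_const (φ c)).indicator (hℓ c)]
  refine Finset.sum_congr rfl fun c _ => ?_
  rw [integral_indicator_const _ (hℓ c), smul_eq_mul]

lemma measurable_comp_label (hℓ : ∀ c, MeasurableSet (ℓ ⁻¹' {c})) (φ : ι → ℝ) :
    Measurable fun x => φ (ℓ x) := by
  rw [comp_eq_sum_indicator]
  exact Finset.measurable_fun_sum _ fun c _ => measurable_const.indicator (hℓ c)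

lemma sum_real_label (hℓ : ∀ c, MeasurableSet (ℓ ⁻¹' {c})) (α : Measure X)
    [IsProbabilityMeasure α] : ∑ c, α.real (ℓ ⁻¹' {c}) = 1 := by
  have := integral_comp_label hℓ α fun _ => 1
  simpa using this.symm

/-- The divergence of two measures relative to a finite partition. -/
noncomputable def cellDiv (ℓ : X → ι) (α β : Measure X) : ℝ :=
  ∑ c, (α.real (ℓ ⁻¹' {c}) * Real.log (α.real (ℓ ⁻¹' {c}))
    - α.real (ℓ ⁻¹' {c}) * Real.log (β.real (ℓ ⁻¹' {c})))

variable {α β : Measure X} [IsProbabilityMeasure α] [IsProbabilityMeasure β]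

/-- The Gibbs inequality with zero test function. Absolute continuity on cells is a hypothesis
because `Real.log 0 = 0` would hide an infinite divergence. -/
lemma cellDiv_nonneg (hℓ : ∀ c, MeasurableSet (ℓ ⁻¹' {c}))
    (hac : ∀ c, β.real (ℓ ⁻¹' {c}) = 0 → α.real (ℓ ⁻¹' {c}) = 0) : 0 ≤ cellDiv ℓ α β := by
  have := sum_mul_sub_log_sum_le (fun _ => 0) (fun c => measureReal_nonneg)
    (fun c => measureReal_nonneg) (sum_real_label hℓ α) (sum_real_label hℓ β) hac
  simpa [cellDiv, sum_real_label hℓ β] using this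

/-- Replace `f` by its value at one chosen point of each cell, at the cost `2 * η`, and apply the
Gibbs inequality to the cells. -/
lemma dv_le_cellDiv_add (hℓ : ∀ c, MeasurableSet (ℓ ⁻¹' {c}))
    (hac : ∀ c, β.real (ℓ ⁻¹' {c}) = 0 → α.real (ℓ ⁻¹' {c}) = 0)
    {f : X → ℝ} (hf : Measurable f) {M η : ℝ} (hM : ∀ x, |f x| ≤ M)
    (hosc : ∀ x y, ℓ x = ℓ y → |f x - f y| ≤ η) : dv α β f ≤ cellDiv ℓ α β + 2 * η := by
  classical
  let t : ι → ℝ := fun c => if h : ∃ x, ℓ x = c then f h.choose else 0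
  have hM0 : 0 ≤ M := by
    have : Nonempty X := nonempty_of_isProbabilityMeasure α
    exact (abs_nonneg _).trans (hM (Classical.arbitrary X))
  have ht : ∀ c, |t c| ≤ M := fun c => by
    simp only [t]
    split_ifs
    · exact hM _
    · simpa using hM0
  have hft : ∀ x, |f x - t (ℓ x)| ≤ η := fun x => by
    have h : ∃ y, ℓ y = ℓ x := ⟨x, rfl⟩
    simp only [t, h, dif_pos]
    exact hosc _ _ h.choose_spec.symm
  have h1 := dv_le_dv_add (α := α) (β := β) hf (measurable_comp_label hℓ t) hM
    (fun x => ht (ℓ x)) hft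
  have h2 := sum_mul_sub_log_sum_le t (fun c => measureReal_nonneg)
    (fun c => measureReal_nonneg) (sum_real_label hℓ α) (sum_real_label hℓ β) hac
  have h3 : dv α β (fun x => t (ℓ x)) ≤ cellDiv ℓ α β := by
    unfold dv cellDiv
    rw [integral_comp_label hℓ α t, integral_comp_label hℓ β fun c => Real.exp (t c)]
    exact h2
  linarith

lemma maxDV_le_cellDiv_add [TopologicalSpace X] [CompactSpace X] [BorelSpace X]
    (hℓ : ∀ c, MeasurableSet (ℓ ⁻¹' {c}))
    (hac : ∀ c, β.real (ℓ ⁻¹' {c}) = 0 → α.real (ℓ ⁻¹' {c}) = 0)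
    (D : ℕ → C(X, ℝ)) {η : ℝ} (hη : 0 ≤ η) (N : ℕ)
    (hosc : ∀ i < N, ∀ x y, ℓ x = ℓ y → |D i x - D i y| ≤ η) :
    maxDV D α β N ≤ cellDiv ℓ α β + 2 * η := by
  induction N with
  | zero =>
    have := cellDiv_nonneg (α := α) (β := β) hℓ hac
    simp only [maxDV]
    linarith
  | succ N ih =>
    refine max_le (ih fun i hi => hosc i (hi.trans (Nat.lt_succ_self N))) ?_
    exact dv_le_cellDiv_add hℓ hac (D N).continuous.measurable
      (fun x => (D N).norm_coe_le_norm x) (hosc N (Nat.lt_succ_self N))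

end CellSum

/-! ### Entropy of pulled back partitions and its decrease under a random step. -/

section CellEntropy

variable {d : ℕ} {ι : Type*} [Fintype ι] {ℓ : Proj d → ι} {μ : Measure SL(d, ℝ)}
  [IsProbabilityMeasure μ] {ν : Measure (Proj d)} [IsProbabilityMeasure ν]

lemma isProbabilityMeasure_map_smul (ν : Measure (Proj d)) [IsProbabilityMeasure ν]
    (A : SL(d, ℝ)) : IsProbabilityMeasure (ν.map fun ξ => A • ξ) :=
  Measure.isProbabilityMeasure_map (measurable_smul_left A).aemeasurable

/-- The mass which the image of `ν` under `B` gives to a cell. -/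
noncomputable def cellMass (ν : Measure (Proj d)) (ℓ : Proj d → ι) (c : ι) (B : SL(d, ℝ)) : ℝ :=
  ν.real {ξ | ℓ (B • ξ) = c}

lemma measurableSet_label_smul (hℓ : ∀ c, MeasurableSet (ℓ ⁻¹' {c})) (B : SL(d, ℝ)) (c : ι) :
    MeasurableSet {ξ | ℓ (B • ξ) = c} :=
  (measurable_smul_left B) (hℓ c)

lemma measurable_cellMass (hℓ : ∀ c, MeasurableSet (ℓ ⁻¹' {c})) (c : ι) :
    Measurable (cellMass ν ℓ c) :=
  (measurable_measure_prodMk_left (measurable_smul_prod (hℓ c))).ennreal_toReal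

lemma cellMass_nonneg (c : ι) (B : SL(d, ℝ)) : 0 ≤ cellMass ν ℓ c B := measureReal_nonneg

lemma cellMass_le_one (c : ι) (B : SL(d, ℝ)) : cellMass ν ℓ c B ≤ 1 := measureReal_le_one

lemma real_map_smul_label (hℓ : ∀ c, MeasurableSet (ℓ ⁻¹' {c})) (A B : SL(d, ℝ)) (c : ι) :
    (ν.map fun ξ => A • ξ).real ((fun ξ => ℓ (B • ξ)) ⁻¹' {c}) = cellMass ν ℓ c (B * A) := by
  refine (map_measureReal_apply (measurable_smul_left A)
    (measurableSet_label_smul hℓ B c)).trans ?_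
  simp only [cellMass, mul_smul]
  rfl

/-- Stationarity tested on the pulled back cell. The random factor stands on the right, next to `ν`.
-/
lemma integral_cellMass_mul (hν : IsStationary μ ν) (hℓ : ∀ c, MeasurableSet (ℓ ⁻¹' {c}))
    (B : SL(d, ℝ)) (c : ι) : ∫ A, cellMass ν ℓ c (B * A) ∂μ = cellMass ν ℓ c B := by
  have hm : Measurable fun A : SL(d, ℝ) => cellMass ν ℓ c (B * A) :=
    (measurable_cellMass hℓ c).comp (measurable_const_mul B)
  rw [integral_eq_lintegral_of_nonneg_ae (ae_of_all _ fun A => cellMass_nonneg c _)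
    hm.aestronglyMeasurable]
  have h := hν _ (measurableSet_label_smul hℓ B c)
  conv_rhs => rw [cellMass, measureReal_def, h]
  congr 1
  refine lintegral_congr fun A => ?_
  rw [← real_map_smul_label hℓ]
  have := isProbabilityMeasure_map_smul ν A
  exact ENNReal.ofReal_toReal (measure_ne_top _ _)

/-- The Shannon entropy of the image of `ν` under `B` relative to a partition. -/
noncomputable def cellEntropy (ν : Measure (Proj d)) (ℓ : Proj d → ι) (B : SL(d, ℝ)) : ℝ :=
  ∑ c, Real.negMulLog (cellMass ν ℓ c B)

lemma cellEntropy_nonneg (B : SL(d, ℝ)) : 0 ≤ cellEntropy ν ℓ B :=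
  Finset.sum_nonneg fun c _ =>
    Real.negMulLog_nonneg (cellMass_nonneg c B) (cellMass_le_one c B)

lemma measurable_cellEntropy (hℓ : ∀ c, MeasurableSet (ℓ ⁻¹' {c})) :
    Measurable (cellEntropy ν ℓ) :=
  Finset.measurable_fun_sum _ fun c _ =>
    Real.continuous_negMulLog.measurable.comp (measurable_cellMass hℓ c)

lemma sum_cellMass (hℓ : ∀ c, MeasurableSet (ℓ ⁻¹' {c})) (B : SL(d, ℝ)) :
    ∑ c, cellMass ν ℓ c B = 1 :=
  sum_real_label (ℓ := fun ξ => ℓ (B • ξ)) (measurableSet_label_smul hℓ B) ν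

/-- The Gibbs inequality against the uniform distribution. -/
lemma cellEntropy_le (hℓ : ∀ c, MeasurableSet (ℓ ⁻¹' {c})) (B : SL(d, ℝ)) :
    cellEntropy ν ℓ B ≤ Real.log (Fintype.card ι) := by
  have hne : Nonempty ι := by
    by_contra h
    rw [not_nonempty_iff] at h
    have := sum_cellMass (ν := ν) hℓ B
    simp at this
  have hcard : (0 : ℝ) < Fintype.card ι := by exact_mod_cast Fintype.card_pos
  have h := sum_mul_sub_log_sum_le (p := fun c => cellMass ν ℓ c B)
    (q := fun _ => (Fintype.card ι : ℝ)⁻¹) (fun _ => 0) (fun c => cellMass_nonneg c B)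
    (fun c => by positivity) (sum_cellMass hℓ B)
    (by simp) fun c hc => absurd hc (by positivity)
  simp only [mul_zero, Finset.sum_const_zero, Real.exp_zero, mul_one, Finset.sum_const,
    Finset.card_univ, nsmul_eq_mul, mul_inv_cancel₀ hcard.ne', Real.log_one, sub_zero,
    Finset.sum_sub_distrib, ← Finset.sum_mul, sum_cellMass hℓ B, Real.log_inv] at h
  have h2 : cellEntropy ν ℓ B = -∑ c, cellMass ν ℓ c B * Real.log (cellMass ν ℓ c B) := by
    rw [cellEntropy, ← Finset.sum_neg_distrib]
    exact Finset.sum_congr rfl fun c _ => by rw [Real.negMulLog, neg_mul]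
  rw [h2]
  linarith

lemma integrable_cellEntropy_comp {Ω : Type*} [MeasurableSpace Ω] {P : Measure Ω}
    [IsFiniteMeasure P] (hℓ : ∀ c, MeasurableSet (ℓ ⁻¹' {c})) {Z : Ω → SL(d, ℝ)}
    (hZ : Measurable Z) : Integrable (fun ω => cellEntropy ν ℓ (Z ω)) P :=
  (integrable_const (Real.log (Fintype.card ι))).mono'
    ((measurable_cellEntropy hℓ).comp hZ).aestronglyMeasurable (ae_of_all _ fun ω => by
      rw [Real.norm_of_nonneg (cellEntropy_nonneg _)]
      exact cellEntropy_le hℓ _)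

lemma integrable_cellMass_mul (hℓ : ∀ c, MeasurableSet (ℓ ⁻¹' {c})) (B : SL(d, ℝ)) (c : ι) :
    Integrable (fun A => cellMass ν ℓ c (B * A)) μ :=
  integrable_of_abs_le ((measurable_cellMass hℓ c).comp (measurable_const_mul B)) (M := 1)
    fun A => by
      rw [abs_of_nonneg (cellMass_nonneg c _)]
      exact cellMass_le_one c _

/-- The cross term is linear in the masses for `B * A`, so stationarity averages it to the entropy
for `B`. -/
lemma cellDiv_map_smul (hℓ : ∀ c, MeasurableSet (ℓ ⁻¹' {c})) (A B : SL(d, ℝ)) :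
    cellDiv (fun ξ => ℓ (B • ξ)) (ν.map fun ξ => A • ξ) ν = -cellEntropy ν ℓ (B * A)
      - ∑ c, cellMass ν ℓ c (B * A) * Real.log (cellMass ν ℓ c B) := by
  rw [cellDiv, cellEntropy, ← Finset.sum_neg_distrib, ← Finset.sum_sub_distrib]
  refine Finset.sum_congr rfl fun c _ => ?_
  rw [real_map_smul_label hℓ, Real.negMulLog, neg_mul, neg_neg]
  rfl

lemma integrable_cellDiv (hℓ : ∀ c, MeasurableSet (ℓ ⁻¹' {c})) (B : SL(d, ℝ)) :
    Integrable (fun A => cellDiv (fun ξ => ℓ (B • ξ)) (ν.map fun ξ => A • ξ) ν) μ := by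
  simp only [cellDiv_map_smul hℓ]
  exact (integrable_cellEntropy_comp hℓ (measurable_const_mul B)).neg.sub
    (integrable_finsetSum _ fun c _ => (integrable_cellMass_mul hℓ B c).mul_const _)

/-- The mean divergence is an increment of the entropy. -/
lemma integral_cellDiv (hν : IsStationary μ ν) (hℓ : ∀ c, MeasurableSet (ℓ ⁻¹' {c}))
    (B : SL(d, ℝ)) :
    ∫ A, cellDiv (fun ξ => ℓ (B • ξ)) (ν.map fun ξ => A • ξ) ν ∂μ =
      cellEntropy ν ℓ B - ∫ A, cellEntropy ν ℓ (B * A) ∂μ := by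
  simp only [cellDiv_map_smul hℓ]
  have h1 : Integrable (fun A => -cellEntropy ν ℓ (B * A)) μ :=
    (integrable_cellEntropy_comp hℓ (measurable_const_mul B)).neg
  have h2 : ∀ c, Integrable
      (fun A => cellMass ν ℓ c (B * A) * Real.log (cellMass ν ℓ c B)) μ := fun c =>
    (integrable_cellMass_mul hℓ B c).mul_const _
  rw [integral_sub h1 (integrable_finsetSum _ fun c _ => h2 c), integral_neg,
    integral_finsetSum _ fun c _ => h2 c]
  simp only [integral_mul_const, integral_cellMass_mul hν hℓ]
  have h3 : cellEntropy ν ℓ B = -∑ c, cellMass ν ℓ c B * Real.log (cellMass ν ℓ c B) := by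
    rw [cellEntropy, ← Finset.sum_neg_distrib]
    exact Finset.sum_congr rfl fun c _ => by rw [Real.negMulLog, neg_mul]
  rw [h3]
  ring

/-- A nonnegative function of mean zero vanishes almost everywhere. This supplies the absolute
continuity on cells. -/
lemma ae_cellMass_mul_eq_zero (hν : IsStationary μ ν) (hℓ : ∀ c, MeasurableSet (ℓ ⁻¹' {c}))
    (B : SL(d, ℝ)) : ∀ᵐ A ∂μ, ∀ c, cellMass ν ℓ c B = 0 → cellMass ν ℓ c (B * A) = 0 := by
  refine ae_all_iff.2 fun c => ?_
  by_cases h : cellMass ν ℓ c B = 0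
  · have h0 := (integral_eq_zero_iff_of_nonneg (fun A => cellMass_nonneg c (B * A))
      (integrable_cellMass_mul hℓ B c)).1 ((integral_cellMass_mul hν hℓ B c).trans h)
    filter_upwards [h0] with A hA _ using hA
  · exact ae_of_all _ fun A h' => absurd h' h

lemma integral_cellEntropy_mul_le (hν : IsStationary μ ν) (hℓ : ∀ c, MeasurableSet (ℓ ⁻¹' {c}))
    (B : SL(d, ℝ)) : ∫ A, cellEntropy ν ℓ (B * A) ∂μ ≤ cellEntropy ν ℓ B := by
  rw [← sub_nonneg, ← integral_cellDiv hν hℓ B]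
  refine integral_nonneg_of_ae ?_
  filter_upwards [ae_cellMass_mul_eq_zero hν hℓ B] with A hA
  have := isProbabilityMeasure_map_smul ν A
  exact cellDiv_nonneg (measurableSet_label_smul hℓ B) fun c hc => by
    rw [real_map_smul_label hℓ]
    exact hA c hc

lemma measurable_dv_map (f : C(Proj d, ℝ)) :
    Measurable fun A : SL(d, ℝ) => dv (ν.map fun ξ => A • ξ) ν f := by
  have h : ∀ A : SL(d, ℝ), dv (ν.map fun ξ => A • ξ) ν f =
      ∫ ξ, f (A • ξ) ∂ν - Real.log (∫ ξ, Real.exp (f ξ) ∂ν) := fun A => by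
    rw [dv, integral_map (measurable_smul_left A).aemeasurable
      f.continuous.measurable.aestronglyMeasurable]
  simp only [h]
  refine Measurable.sub_const ?_ _
  exact ((f.continuous.measurable.comp measurable_smul_prod).stronglyMeasurable
    |>.integral_prod_right').measurable

lemma measurable_maxDV_map (D : ℕ → C(Proj d, ℝ)) (N : ℕ) :
    Measurable fun A : SL(d, ℝ) => maxDV D (ν.map fun ξ => A • ξ) ν N := by
  induction N with
  | zero => exact measurable_const
  | succ N ih => exact ih.max (measurable_dv_map (D N))

lemma exists_maxDV_le (D : ℕ → C(Proj d, ℝ)) (N : ℕ) :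
    ∃ M : ℝ, ∀ A : SL(d, ℝ), maxDV D (ν.map fun ξ => A • ξ) ν N ≤ M := by
  induction N with
  | zero => exact ⟨0, fun A => le_rfl⟩
  | succ N ih =>
    obtain ⟨M, hM⟩ := ih
    refine ⟨max M (0 + 2 * ‖D N‖), fun A => max_le_max (hM A) ?_⟩
    have := isProbabilityMeasure_map_smul ν A
    -- Comparison with the zero function, whose functional is zero, gives a bound independent of
    -- `A`.
    have h := dv_le_dv_add (α := ν.map fun ξ => A • ξ) (β := ν) (D N).continuous.measurable
      (measurable_const (a := (0 : ℝ))) (fun x => (D N).norm_coe_le_norm x) (N := 0) (by simp)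
      (ε := ‖D N‖) fun x => by simpa using (D N).norm_coe_le_norm x
    simpa [dv] using h

lemma integrable_maxDV_map (D : ℕ → C(Proj d, ℝ)) (N : ℕ) :
    Integrable (fun A : SL(d, ℝ) => maxDV D (ν.map fun ξ => A • ξ) ν N) μ := by
  obtain ⟨M, hM⟩ := exists_maxDV_le (ν := ν) D N
  exact integrable_of_abs_le (measurable_maxDV_map D N) fun A => by
    rw [abs_of_nonneg (maxDV_nonneg _ _ _ _)]
    exact hM A

lemma integral_maxDV_le (hν : IsStationary μ ν) (hℓ : ∀ c, MeasurableSet (ℓ ⁻¹' {c}))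
    (B : SL(d, ℝ)) (D : ℕ → C(Proj d, ℝ)) {η : ℝ} (hη : 0 ≤ η) (N : ℕ)
    (hosc : ∀ i < N, ∀ ξ ξ', ℓ (B • ξ) = ℓ (B • ξ') → |D i ξ - D i ξ'| ≤ η) :
    ∫ A, maxDV D (ν.map fun ξ => A • ξ) ν N ∂μ - 2 * η ≤
      cellEntropy ν ℓ B - ∫ A, cellEntropy ν ℓ (B * A) ∂μ := by
  rw [← integral_cellDiv hν hℓ B, sub_le_iff_le_add]
  calc ∫ A, maxDV D (ν.map fun ξ => A • ξ) ν N ∂μ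
      ≤ ∫ A, (cellDiv (fun ξ => ℓ (B • ξ)) (ν.map fun ξ => A • ξ) ν + 2 * η) ∂μ := by
        refine integral_mono_ae (integrable_maxDV_map D N)
          ((integrable_cellDiv hℓ B).add (integrable_const _)) ?_
        filter_upwards [ae_cellMass_mul_eq_zero hν hℓ B] with A hA
        have := isProbabilityMeasure_map_smul ν A
        exact maxDV_le_cellDiv_add (measurableSet_label_smul hℓ B) (fun c hc => by
          rw [real_map_smul_label hℓ]
          exact hA c hc) D hη N hosc
    _ = _ := by
      rw [integral_add (integrable_cellDiv hℓ B) (integrable_const _)]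
      simp

end CellEntropy

/-! ### Counting entropy drops along the random product. -/

section EntropyBound

variable {d : ℕ} {μ : Measure SL(d, ℝ)} [IsProbabilityMeasure μ] {ν : Measure (Proj d)}
  [IsProbabilityMeasure ν]

section Average

variable {ι : Type*} [Fintype ι] {ℓ : Proj d → ι}

/-- The mean entropy of the image of `ν` under the `k`-fold product. -/
noncomputable def meanEntropy (μ : Measure SL(d, ℝ)) (ν : Measure (Proj d)) (ℓ : Proj d → ι)
    (k : ℕ) : ℝ :=
  ∫ x, cellEntropy ν ℓ (partialProd x k) ∂(Measure.infinitePi fun _ : ℕ => μ)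

lemma integrable_cellEntropy_prod (hℓ : ∀ c, MeasurableSet (ℓ ⁻¹' {c})) (k : ℕ) :
    Integrable (fun p : SL(d, ℝ) × (ℕ → SL(d, ℝ)) => cellEntropy ν ℓ (partialProd p.2 k * p.1))
      (μ.prod (Measure.infinitePi fun _ : ℕ => μ)) :=
  integrable_cellEntropy_comp hℓ (((measurable_partialProd k).comp measurable_snd).mul
    measurable_fst)

/-- A product of `k + 1` factors is the product over the tail times the head, so the independent new
factor enters on the right, where stationarity acts. -/
lemma meanEntropy_succ (hℓ : ∀ c, MeasurableSet (ℓ ⁻¹' {c})) (k : ℕ) :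
    meanEntropy μ ν ℓ (k + 1) = ∫ y, ∫ A, cellEntropy ν ℓ (partialProd y k * A) ∂μ
      ∂(Measure.infinitePi fun _ : ℕ => μ) := by
  have hint := integrable_cellEntropy_prod (μ := μ) (ν := ν) hℓ k
  rw [← integral_prod_symm _ hint, ← map_head_tail μ]
  rw [integral_map (by fun_prop) (by rw [map_head_tail]; exact hint.aestronglyMeasurable)]
  unfold meanEntropy
  simp only [partialProd_add, partialProd_one]

/-- On `S` the conditional drop is at least the stated constant, and elsewhere it is still
nonnegative. -/
lemma mul_measureReal_le_meanEntropy_sub (hν : IsStationary μ ν)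
    (hℓ : ∀ c, MeasurableSet (ℓ ⁻¹' {c})) (D : ℕ → C(Proj d, ℝ)) {η : ℝ} (hη : 0 ≤ η)
    (N k : ℕ) {S : Set (ℕ → SL(d, ℝ))} (hS : MeasurableSet S)
    (hosc : ∀ y ∈ S, ∀ i < N, ∀ ξ ξ', ℓ (partialProd y k • ξ) = ℓ (partialProd y k • ξ') →
      |D i ξ - D i ξ'| ≤ η) :
    (∫ A, maxDV D (ν.map fun ξ => A • ξ) ν N ∂μ - 2 * η) *
      (Measure.infinitePi fun _ : ℕ => μ).real S ≤
      meanEntropy μ ν ℓ k - meanEntropy μ ν ℓ (k + 1) := by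
  set κ := ∫ A, maxDV D (ν.map fun ξ => A • ξ) ν N ∂μ - 2 * η
  have hint2 := (integrable_cellEntropy_prod (μ := μ) (ν := ν) hℓ k).integral_prod_right
  have hint1 : Integrable (fun y => cellEntropy ν ℓ (partialProd y k))
      (Measure.infinitePi fun _ : ℕ => μ) :=
    integrable_cellEntropy_comp hℓ (measurable_partialProd k)
  rw [meanEntropy_succ hℓ, meanEntropy, ← integral_sub hint1 hint2, mul_comm κ, ← smul_eq_mul,
    ← integral_indicator_const κ hS]
  refine integral_mono ((integrable_const κ).indicator hS) (hint1.sub hint2) fun y => ?_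
  by_cases hy : y ∈ S
  · rw [Set.indicator_of_mem hy]
    change κ ≤ cellEntropy ν ℓ (partialProd y k) - ∫ A, cellEntropy ν ℓ (partialProd y k * A) ∂μ
    exact integral_maxDV_le hν hℓ (partialProd y k) D hη N (hosc y hy)
  · rw [Set.indicator_of_notMem hy]
    exact sub_nonneg.2 (integral_cellEntropy_mul_le hν hℓ (partialProd y k))

end Average

lemma exists_near_forall_dist_le (D : ℕ → C(Proj d, ℝ)) {η : ℝ} (hη : 0 < η) (N : ℕ) :
    ∃ r > 0, ∀ i < N, ∀ ξ ξ', Near r ξ ξ' → |D i ξ - D i ξ'| ≤ η := by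
  induction N with
  | zero => exact ⟨1, one_pos, fun i hi => absurd hi (Nat.not_lt_zero i)⟩
  | succ N ih =>
    obtain ⟨r, hr, h⟩ := ih
    obtain ⟨r', hr', h'⟩ := exists_near_dist_le (D N) hη
    refine ⟨min r r', lt_min hr hr', fun i hi ξ ξ' hn => ?_⟩
    rcases Nat.lt_succ_iff_lt_or_eq.1 hi with hi | rfl
    · exact h i hi ξ ξ' (hn.mono (min_le_left _ _))
    · exact h' ξ ξ' (hn.mono (min_le_right _ _))

/-- The event that the distortion of the `k`-fold product is at most `exp (k T)`. -/
def distortionSet (d : ℕ) (T : ℝ) (k : ℕ) : Set (ℕ → SL(d, ℝ)) :=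
  {y | Real.log (opNorm (partialProd y k)) + Real.log (opNorm (partialProd y k)⁻¹) ≤ k * T}

lemma measurableSet_distortionSet (T : ℝ) (k : ℕ) : MeasurableSet (distortionSet d T k) := by
  have h1 : Measurable fun y : ℕ → SL(d, ℝ) => Real.log (opNorm (partialProd y k)) :=
    Real.measurable_log.comp (continuous_opNorm.measurable.comp (measurable_partialProd k))
  have h2 : Measurable fun y : ℕ → SL(d, ℝ) => Real.log (opNorm (partialProd y k)⁻¹) :=
    Real.measurable_log.comp ((continuous_opNorm.comp continuous_inv).measurable.comp
      (measurable_partialProd k))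
  exact measurableSet_le (h1.add h2) measurable_const

lemma opNorm_mul_opNorm_inv_le [NeZero d] {T : ℝ} {k : ℕ} {y : ℕ → SL(d, ℝ)}
    (hy : y ∈ distortionSet d T k) :
    opNorm (partialProd y k) * opNorm (partialProd y k)⁻¹ ≤ Real.exp (k * T) := by
  have h1 := one_le_opNorm (partialProd y k)
  have h2 := one_le_opNorm (partialProd y k)⁻¹
  rw [← Real.log_le_iff_le_exp (by positivity), Real.log_mul (by positivity) (by positivity)]
  exact hy

lemma tendsto_measureReal_distortionSet {γp γm T : ℝ} (hp : IsUpperExponent μ γp)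
    (hm : IsLowerExponent μ γm) (hT : γp - γm < T) :
    Tendsto (fun k => (Measure.infinitePi fun _ : ℕ => μ).real (distortionSet d T k)) atTop
      (𝓝 1) := by
  have h := tendsto_integral_of_dominated_convergence
    (μ := Measure.infinitePi fun _ : ℕ => μ)
    (F := fun k => (distortionSet d T k).indicator fun _ => (1 : ℝ)) (f := fun _ => 1)
    (fun _ => 1)
    (fun k => (measurable_const.indicator (measurableSet_distortionSet T k)).aestronglyMeasurable)
    (integrable_const 1)
    (fun k => ae_of_all _ fun y => by
      by_cases hy : y ∈ distortionSet d T k <;> simp [hy]) ?_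
  · simpa [integral_indicator_const _ (measurableSet_distortionSet T _)] using h
  · filter_upwards [hp, hm] with y hy1 hy2
    refine tendsto_const_nhds.congr' ?_
    filter_upwards [(hy1.sub hy2).eventually (gt_mem_nhds hT), eventually_gt_atTop 0]
      with k hk hk0
    have hk' : (0 : ℝ) < k := by exact_mod_cast hk0
    rw [sub_neg_eq_add, ← mul_add, one_div_mul_eq_div, div_lt_iff₀ hk', mul_comm T] at hk
    have hmem : y ∈ distortionSet d T k := hk.le
    exact (Set.indicator_of_mem hmem fun _ => (1 : ℝ)).symm

lemma integral_maxDV_bound [NeZero d] (hν : IsStationary μ ν) {γp γm : ℝ}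
    (hp : IsUpperExponent μ γp) (hm : IsLowerExponent μ γm) (hγ : 0 ≤ γp - γm)
    (D : ℕ → C(Proj d, ℝ)) (N : ℕ) {ε : ℝ} (hε : 0 < ε) (hε1 : ε < 1) :
    (∫ A, maxDV D (ν.map fun ξ => A • ξ) ν N ∂μ - 2 * ε) * (1 - ε) ≤
      ((d - 1 : ℕ) : ℝ) * (γp - γm + ε) := by
  set κ := ∫ A, maxDV D (ν.map fun ξ => A • ξ) ν N ∂μ - 2 * ε
  set T := γp - γm + ε with hTdef
  set P := Measure.infinitePi fun _ : ℕ => μ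
  have hT0 : 0 < T := by linarith
  have hd0 : (0 : ℝ) < d := by exact_mod_cast Nat.pos_of_ne_zero (NeZero.ne d)
  rcases lt_or_ge κ 0 with hκ | hκ
  · have h1 : κ * (1 - ε) ≤ 0 := mul_nonpos_of_nonpos_of_nonneg hκ.le (by linarith)
    exact h1.trans (by positivity)
  obtain ⟨r, hr, hD⟩ := exists_near_forall_dist_le D hε N
  obtain ⟨k₀, hk₀⟩ := eventually_atTop.1 ((tendsto_measureReal_distortionSet hp hm
    (show γp - γm < T by linarith)).eventually (lt_mem_nhds (show 1 - ε < 1 by linarith)))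
  -- By `Near.of_smul`, cells of size 1/m pulled back with distortion at most exp(nT) have size at
  -- most 2 d² exp(nT) / m, which is at most `r` once m ≥ c exp(nT).
  set c : ℝ := 2 * d * d / r with hc
  have hc0 : 0 < c := by positivity
  -- One partition, adapted to `n`, serves all steps from `k₀` to `n`. The total drop of the mean
  -- entropy is at most the logarithm of the number of cells.
  have key : ∀ n ≥ k₀, κ * (1 - ε) * (n - k₀) ≤
      Real.log d + ((d - 1 : ℕ) : ℝ) * (Real.log (2 * c + 3) + n * T) := by
    intro n hn
    set m := ⌈c * Real.exp (n * T)⌉₊ with hmdef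
    have hcm : c * Real.exp (n * T) ≤ m := Nat.le_ceil _
    have hm0 : 0 < m := Nat.ceil_pos.2 (by positivity)
    have hm0' : (0 : ℝ) < m := by exact_mod_cast hm0
    obtain ⟨ι, _, ℓ, hℓ, hcard, hnear⟩ := exists_partition d m hm0
    have hstep : ∀ k, k₀ ≤ k → k < n →
        κ * (1 - ε) ≤ meanEntropy μ ν ℓ k - meanEntropy μ ν ℓ (k + 1) := by
      intro k hk hkn
      refine le_trans (mul_le_mul_of_nonneg_left (hk₀ k hk).le hκ)
        (mul_measureReal_le_meanEntropy_sub hν hℓ D hε.le N k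
          (measurableSet_distortionSet T k) fun y hy i hi ξ ξ' h => ?_)
      refine hD i hi ξ ξ' ((hnear _ _ h).of_smul.mono ?_)
      have h1 := opNorm_mul_opNorm_inv_le hy
      have h2 : Real.exp (k * T) ≤ Real.exp (n * T) := Real.exp_le_exp.2 (by gcongr)
      calc 2 * (d * opNorm (partialProd y k)) * (d * opNorm (partialProd y k)⁻¹) * (1 / m)
          = c * (opNorm (partialProd y k) * opNorm (partialProd y k)⁻¹) * r / m := by
            rw [hc]; field_simp
        _ ≤ m * r / m := by
            gcongr
            exact (mul_le_mul_of_nonneg_left (h1.trans h2) hc0.le).trans hcm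
        _ = r := by field_simp
    have hsum : ∀ j, k₀ + j ≤ n →
        κ * (1 - ε) * j ≤ meanEntropy μ ν ℓ k₀ - meanEntropy μ ν ℓ (k₀ + j) := by
      intro j
      induction j with
      | zero => simp
      | succ j ih =>
        intro hj
        have h1 := ih (by omega)
        have h2 := hstep (k₀ + j) (by omega) (by omega)
        push_cast
        rw [← add_assoc]
        linarith
    obtain ⟨j, rfl⟩ := Nat.exists_eq_add_of_le hn
    have h1 := hsum j le_rfl
    have h2 : 0 ≤ meanEntropy μ ν ℓ (k₀ + j) := integral_nonneg fun _ => cellEntropy_nonneg _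
    have hne : Nonempty ι := ⟨ℓ (Classical.choice (nonempty_of_isProbabilityMeasure ν))⟩
    have hcard0 : (0 : ℝ) < Fintype.card ι := by exact_mod_cast Fintype.card_pos
    have h3 : meanEntropy μ ν ℓ k₀ ≤ Real.log (Fintype.card ι) := by
      calc meanEntropy μ ν ℓ k₀ ≤ ∫ _, Real.log (Fintype.card ι) ∂P :=
            integral_mono (integrable_cellEntropy_comp hℓ (measurable_partialProd k₀))
              (integrable_const _) fun y => cellEntropy_le hℓ _
        _ = _ := by simp [P]
    have h4 : Real.log (Fintype.card ι) ≤
        Real.log d + ((d - 1 : ℕ) : ℝ) * Real.log (2 * m + 1) := by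
      rw [← Real.log_pow, ← Real.log_mul hd0.ne' (by positivity)]
      refine Real.log_le_log hcard0 ?_
      exact_mod_cast hcard
    have h5 : Real.log (2 * m + 1) ≤ Real.log (2 * c + 3) + (k₀ + j : ℕ) * T := by
      rw [← Real.log_exp ((k₀ + j : ℕ) * T), ← Real.log_mul (by positivity) (by positivity)]
      refine Real.log_le_log (by positivity) ?_
      have h6 : (m : ℝ) < c * Real.exp ((k₀ + j : ℕ) * T) + 1 := Nat.ceil_lt_add_one (by positivity)
      have h7 : 1 ≤ Real.exp ((k₀ + j : ℕ) * T) := Real.one_le_exp (by positivity)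
      linarith
    have h6 := mul_le_mul_of_nonneg_left h5 (Nat.cast_nonneg (α := ℝ) (d - 1))
    push_cast at h6 ⊢
    rw [add_sub_cancel_left]
    linarith
  -- Both sides of `key` are affine in `n`, so their slopes compare.
  by_contra! hlt
  set u := κ * (1 - ε)
  set v := ((d - 1 : ℕ) : ℝ) * T
  obtain ⟨n, hn⟩ := exists_nat_gt
    ((Real.log d + ((d - 1 : ℕ) : ℝ) * Real.log (2 * c + 3) + u * k₀) / (u - v))
  rw [div_lt_iff₀ (sub_pos.2 hlt)] at hn
  have h1 := key (max n k₀) (le_max_right _ _)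
  have h2 : (n : ℝ) * (u - v) ≤ (max n k₀ : ℕ) * (u - v) :=
    mul_le_mul_of_nonneg_right (by exact_mod_cast le_max_left n k₀) (sub_pos.2 hlt).le
  have h3 : ((d - 1 : ℕ) : ℝ) * (Real.log (2 * c + 3) + (max n k₀ : ℕ) * T) =
      ((d - 1 : ℕ) : ℝ) * Real.log (2 * c + 3) + (max n k₀ : ℕ) * v := by
    simp only [v]; ring
  rw [h3] at h1
  linarith

lemma integral_maxDV_le_exponents [NeZero d] (hν : IsStationary μ ν) {γp γm : ℝ}
    (hp : IsUpperExponent μ γp) (hm : IsLowerExponent μ γm) (hγ : 0 ≤ γp - γm)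
    (D : ℕ → C(Proj d, ℝ)) (N : ℕ) :
    ∫ A, maxDV D (ν.map fun ξ => A • ξ) ν N ∂μ ≤ ((d - 1 : ℕ) : ℝ) * (γp - γm) := by
  set I := ∫ A, maxDV D (ν.map fun ξ => A • ξ) ν N ∂μ
  have h1 : Tendsto (fun ε : ℝ => (I - 2 * ε) * (1 - ε)) (𝓝[>] 0)
      (𝓝 ((I - 2 * 0) * (1 - 0))) :=
    tendsto_nhdsWithin_of_tendsto_nhds (Continuous.tendsto (by fun_prop) 0)
  have h2 : Tendsto (fun ε : ℝ => ((d - 1 : ℕ) : ℝ) * (γp - γm + ε)) (𝓝[>] 0)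
      (𝓝 (((d - 1 : ℕ) : ℝ) * (γp - γm + 0))) :=
    tendsto_nhdsWithin_of_tendsto_nhds (Continuous.tendsto (by fun_prop) 0)
  simp only [mul_zero, sub_zero, mul_one, add_zero] at h1 h2
  refine le_of_tendsto_of_tendsto h1 h2 ?_
  filter_upwards [self_mem_nhdsWithin, mem_nhdsWithin_of_mem_nhds (gt_mem_nhds one_pos)]
    with ε hε hε1
  exact integral_maxDV_bound hν hp hm hγ D N hε hε1

-- The change of variables by `A` turns the integrand into the log-likelihood ratio under the image
-- measure. The total mass correction in `klDiv` cancels for probability measures.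
open InformationTheory in
lemma entropyAt_eq_klDiv (ν : Measure (Proj d)) [IsProbabilityMeasure ν] (A : SL(d, ℝ)) :
    entropyAt ν A = klDiv (ν.map fun ξ => A • ξ) ν := by
  have := isProbabilityMeasure_map_smul ν A
  set α := ν.map fun ξ => A • ξ with hα
  have hmeas : AEStronglyMeasurable (llr α ν) α :=
    (Measure.measurable_rnDeriv α ν).ennreal_toReal.log.aestronglyMeasurable
  have hint : Integrable (fun ξ => Real.log (α.rnDeriv ν (A • ξ)).toReal) ν ↔
      Integrable (llr α ν) α :=
    (integrable_map_measure hmeas (measurable_smul_left A).aemeasurable).symm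
  have hval : ∫ ξ, Real.log (α.rnDeriv ν (A • ξ)).toReal ∂ν = ∫ ξ, llr α ν ξ ∂α :=
    (integral_map (measurable_smul_left A).aemeasurable hmeas).symm
  unfold entropyAt
  rw [← hα, hint, hval]
  split_ifs with h
  · rw [klDiv_of_ac_of_integrable h.1 h.2]
    simp
  · rw [not_and_or] at h
    rcases h with h | h
    · rw [klDiv_of_not_ac h]
    · rw [klDiv_of_not_integrable h]

/-- The entropy bound for a stationary measure. -/
theorem entropy_le [NeZero d] (hν : IsStationary μ ν) {γp γm : ℝ}
    (hp : IsUpperExponent μ γp) (hm : IsLowerExponent μ γm) (hγ : 0 ≤ γp - γm) :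
    entropy μ ν ≤ ENNReal.ofReal (((d - 1 : ℕ) : ℝ) * (γp - γm)) := by
  have : Nonempty (Proj d) := nonempty_of_isProbabilityMeasure ν
  have hD := TopologicalSpace.denseRange_denseSeq C(Proj d, ℝ)
  set D := TopologicalSpace.denseSeq C(Proj d, ℝ)
  calc entropy μ ν ≤ ∫⁻ A, ⨆ N, ENNReal.ofReal (maxDV D (ν.map fun ξ => A • ξ) ν N) ∂μ := by
        -- Monotonicity does not require measurability of `entropyAt`; monotone convergence uses
        -- only that of the `maxDV`.
        refine lintegral_mono fun A => ?_
        rw [entropyAt_eq_klDiv]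
        have := isProbabilityMeasure_map_smul ν A
        exact klDiv_le_iSup_maxDV hD _ _
    _ = ⨆ N, ∫⁻ A, ENNReal.ofReal (maxDV D (ν.map fun ξ => A • ξ) ν N) ∂μ :=
        lintegral_iSup (fun N => (measurable_maxDV_map D N).ennreal_ofReal)
          fun N N' h A => ENNReal.ofReal_le_ofReal (monotone_maxDV D _ _ h)
    _ ≤ _ := by
        refine iSup_le fun N => ?_
        rw [← ofReal_integral_eq_lintegral_ofReal (integrable_maxDV_map D N)
          (ae_of_all _ fun A => maxDV_nonneg _ _ _ _)]
        exact ENNReal.ofReal_le_ofReal (integral_maxDV_le_exponents hν hp hm hγ D N)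

end EntropyBound

/-! ### Existence of stationary measures, and invariance at zero exponents. -/

section Stationary

variable {d : ℕ} {μ : Measure SL(d, ℝ)} [IsProbabilityMeasure μ]

/-- The law after one random step from an initial law. -/
noncomputable def stepLaw (μ : Measure SL(d, ℝ)) (ν : Measure (Proj d)) : Measure (Proj d) :=
  (μ.prod ν).map fun p => p.1 • p.2

instance instIsProbabilityMeasureStepLaw (ν : Measure (Proj d)) [IsProbabilityMeasure ν] :
    IsProbabilityMeasure (stepLaw μ ν) :=
  Measure.isProbabilityMeasure_map measurable_smul_prod.aemeasurable

lemma isStationary_of_stepLaw_eq {ν : Measure (Proj d)} [IsProbabilityMeasure ν]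
    (h : stepLaw μ ν = ν) : IsStationary μ ν := by
  intro s hs
  conv_lhs => rw [← h]
  rw [stepLaw, Measure.map_apply measurable_smul_prod hs,
    Measure.prod_apply (measurable_smul_prod hs)]
  refine lintegral_congr fun A => ?_
  rw [Measure.map_apply (measurable_smul_left A) hs]
  rfl

/-- The Markov operator of the random walk on projective space. -/
noncomputable def markovOp (μ : Measure SL(d, ℝ)) [IsProbabilityMeasure μ] (f : C(Proj d, ℝ)) :
    C(Proj d, ℝ) where
  toFun ξ := ∫ A, f (A • ξ) ∂μ
  continuous_toFun := by
    refine continuous_of_dominated (bound := fun _ => ‖f‖) (fun ξ => ?_) (fun ξ => ?_)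
      (integrable_const _) (ae_of_all _ fun A => ?_)
    · exact (f.continuous.comp (continuous_smul_prod.comp
        (continuous_id.prodMk continuous_const))).measurable.aestronglyMeasurable
    · exact ae_of_all _ fun A => f.norm_coe_le_norm _
    · exact f.continuous.comp (continuous_smul_proj A)

lemma integral_stepLaw (ν : Measure (Proj d)) [IsProbabilityMeasure ν] (f : C(Proj d, ℝ)) :
    ∫ ξ, f ξ ∂(stepLaw μ ν) = ∫ ξ, markovOp μ f ξ ∂ν := by
  have hm : Measurable fun p : SL(d, ℝ) × Proj d => f (p.1 • p.2) :=
    f.continuous.measurable.comp measurable_smul_prod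
  rw [stepLaw, integral_map measurable_smul_prod.aemeasurable
    f.continuous.measurable.aestronglyMeasurable,
    integral_prod_symm _ (integrable_of_abs_le hm fun p => f.norm_coe_le_norm _)]
  rfl

/-- The law of the random walk on projective space after `k` steps. -/
noncomputable def walkLaw (μ : Measure SL(d, ℝ)) (ξ : Proj d) : ℕ → Measure (Proj d)
  | 0 => Measure.dirac ξ
  | k + 1 => stepLaw μ (walkLaw μ ξ k)

instance instIsProbabilityMeasureWalkLaw (ξ : Proj d) (k : ℕ) :
    IsProbabilityMeasure (walkLaw μ ξ k) := by
  induction k with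
  | zero => exact Measure.dirac.isProbabilityMeasure
  | succ k ih => exact instIsProbabilityMeasureStepLaw _

/-- The Cesàro means of the laws of the random walk. -/
noncomputable def cesaroLaw (μ : Measure SL(d, ℝ)) (ξ : Proj d) (n : ℕ) : Measure (Proj d) :=
  ((n + 1 : ℕ) : ℝ≥0∞)⁻¹ • ∑ k ∈ Finset.range (n + 1), walkLaw μ ξ k

instance instIsProbabilityMeasureCesaroLaw (ξ : Proj d) (n : ℕ) :
    IsProbabilityMeasure (cesaroLaw μ ξ n) := by
  refine ⟨?_⟩
  rw [cesaroLaw, Measure.smul_apply, Measure.finsetSum_apply]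
  simp only [measure_univ, Finset.sum_const, Finset.card_range, nsmul_eq_mul, mul_one,
    smul_eq_mul]
  exact ENNReal.inv_mul_cancel (by simp) (ENNReal.natCast_ne_top _)

lemma integrable_continuousMap (ν : Measure (Proj d)) [IsFiniteMeasure ν] (f : C(Proj d, ℝ)) :
    Integrable f ν :=
  integrable_of_abs_le f.continuous.measurable fun ξ => f.norm_coe_le_norm ξ

lemma integral_cesaroLaw (ξ : Proj d) (n : ℕ) (f : C(Proj d, ℝ)) :
    ∫ x, f x ∂(cesaroLaw μ ξ n) =
      ((n : ℝ) + 1)⁻¹ * ∑ k ∈ Finset.range (n + 1), ∫ x, f x ∂(walkLaw μ ξ k) := by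
  rw [cesaroLaw, integral_smul_measure,
    integral_finsetSum_measure fun k _ => integrable_continuousMap _ f, ENNReal.toReal_inv,
    ENNReal.toReal_natCast, smul_eq_mul, Nat.cast_succ]

/-- The Markov operator advances the walk by one step, so the difference of Cesàro means telescopes
to two boundary terms divided by n + 1. -/
lemma tendsto_integral_cesaroLaw_sub (ξ : Proj d) (f : C(Proj d, ℝ)) :
    Tendsto (fun n => ∫ x, markovOp μ f x ∂(cesaroLaw μ ξ n) - ∫ x, f x ∂(cesaroLaw μ ξ n))
      atTop (𝓝 0) := by
  have hval : ∀ n, ∫ x, markovOp μ f x ∂(cesaroLaw μ ξ n) - ∫ x, f x ∂(cesaroLaw μ ξ n) =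
      ((n : ℝ) + 1)⁻¹ * (∫ x, f x ∂(walkLaw μ ξ (n + 1)) - ∫ x, f x ∂(walkLaw μ ξ 0)) := by
    intro n
    rw [integral_cesaroLaw, integral_cesaroLaw, ← mul_sub, ← Finset.sum_sub_distrib]
    congr 1
    rw [← Finset.sum_range_sub fun k => ∫ x, f x ∂(walkLaw μ ξ k)]
    exact Finset.sum_congr rfl fun k _ => by rw [walkLaw, integral_stepLaw]
  have hb : ∀ k, ‖∫ x, f x ∂(walkLaw μ ξ k)‖ ≤ ‖f‖ := fun k => by
    simpa using norm_integral_le_of_norm_le_const (μ := walkLaw μ ξ k)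
      (ae_of_all _ fun x => f.norm_coe_le_norm x)
  have h0 : Tendsto (fun n : ℕ => (1 / ((n : ℝ) + 1)) * (‖f‖ + ‖f‖)) atTop (𝓝 (0 * (‖f‖ + ‖f‖))) :=
    tendsto_one_div_add_atTop_nhds_zero_nat.mul_const _
  rw [zero_mul] at h0
  refine squeeze_zero_norm (fun n => ?_) h0
  rw [hval, norm_mul, one_div, Real.norm_of_nonneg (by positivity : (0 : ℝ) ≤ ((n : ℝ) + 1)⁻¹)]
  exact mul_le_mul_of_nonneg_left ((norm_sub_le _ _).trans (add_le_add (hb _) (hb _)))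
    (by positivity)

lemma isCompact_univ_probabilityMeasure :
    IsCompact (Set.univ : Set (ProbabilityMeasure (Proj d))) := by
  have h := isCompact_setOfPred_probabilityMeasure_mass_eq_compl_isCompact_le
    (E := Proj d) (u := fun _ => 0) (K := fun _ => Set.univ) tendsto_const_nhds
    (fun _ => isCompact_univ) (Or.inl inferInstance)
  simpa using h

/-- Stationary measures exist, by averaging along the random walk. -/
lemma exists_isStationary (μ : Measure SL(d, ℝ)) [IsProbabilityMeasure μ] (ξ : Proj d) :
    ∃ ν : Measure (Proj d), IsProbabilityMeasure ν ∧ IsStationary μ ν := by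
  -- Krylov-Bogolyubov argument, with a limit along an ultrafilter in place of a convergent
  -- subsequence.
  let U : Ultrafilter ℕ := Ultrafilter.of atTop
  have hU : (U : Filter ℕ) ≤ atTop := Ultrafilter.of_le atTop
  let s : ℕ → ProbabilityMeasure (Proj d) := fun n => ⟨cesaroLaw μ ξ n, inferInstance⟩
  obtain ⟨ν, -, hν⟩ := isCompact_univ_probabilityMeasure.ultrafilter_le_nhds (U.map s) (by simp)
  have hlim : Tendsto s U (𝓝 ν) := hν
  rw [ProbabilityMeasure.tendsto_iff_forall_integral_tendsto] at hlim
  refine ⟨ν, inferInstance, isStationary_of_stepLaw_eq ?_⟩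
  refine ext_of_forall_integral_eq_of_IsFiniteMeasure fun f => ?_
  have h1 := hlim f
  have h2 := hlim (BoundedContinuousFunction.mkOfCompact (markovOp μ f.toContinuousMap))
  have h3 := (tendsto_integral_cesaroLaw_sub (μ := μ) ξ f.toContinuousMap).mono_left hU
  have h4 := tendsto_nhds_unique (h2.sub h1) h3
  have h5 := integral_stepLaw (μ := μ) (ν : Measure (Proj d)) f.toContinuousMap
  exact h5.trans (sub_eq_zero.1 h4)

open InformationTheory in
/-- A stationary measure of zero entropy is invariant. -/
lemma ae_map_smul_eq [NeZero d] {ν : Measure (Proj d)} [IsProbabilityMeasure ν]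
    (hν : IsStationary μ ν) (hp : IsUpperExponent μ 0) (hm : IsLowerExponent μ 0) :
    ∀ᵐ A ∂μ, ν.map (fun ξ => A • ξ) = ν := by
  have : Nonempty (Proj d) := nonempty_of_isProbabilityMeasure ν
  have hD := TopologicalSpace.denseRange_denseSeq C(Proj d, ℝ)
  set D := TopologicalSpace.denseSeq C(Proj d, ℝ)
  -- Each `maxDV` is nonnegative with integral at most zero; countably many of them determine
  -- whether the divergence vanishes.
  have h : ∀ᵐ A ∂μ, ∀ N, maxDV D (ν.map fun ξ => A • ξ) ν N = 0 := ae_all_iff.2 fun N => by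
    have h0 := integral_maxDV_le_exponents hν hp hm (by simp) D N
    rw [sub_zero, mul_zero] at h0
    exact (integral_eq_zero_iff_of_nonneg (fun A => maxDV_nonneg _ _ _ _)
      (integrable_maxDV_map D N)).1 (h0.antisymm (integral_nonneg fun A => maxDV_nonneg _ _ _ _))
  filter_upwards [h] with A hA
  have := isProbabilityMeasure_map_smul ν A
  rw [← klDiv_eq_zero_iff]
  refine le_antisymm ((klDiv_le_iSup_maxDV hD _ _).trans ?_) zero_le
  simp [hA]

end Stationary

/-! ### The exponents and the conclusion. -/

section Exponents

variable {d : ℕ} {μ : Measure SL(d, ℝ)} [IsProbabilityMeasure μ]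

lemma exists_isUpperExponent [NeZero d] (h : Integrable (fun A => Real.log (opNorm A)) μ) :
    ∃ γ, 0 ≤ γ ∧ IsUpperExponent μ γ :=
  (isGauge_log_opNorm h).exists_ae_tendsto

lemma exists_isLowerExponent [NeZero d] (h : Integrable (fun A => Real.log (opNorm A)) μ) :
    ∃ γ ≤ 0, IsLowerExponent μ γ := by
  obtain ⟨γ, hγ0, hγ⟩ := (isGauge_log_opNorm_inv h).exists_ae_tendsto
  refine ⟨-γ, neg_nonpos.2 hγ0, ?_⟩
  filter_upwards [hγ] with x hx using hx.neg

/-- This makes the lower exponent vanish together with the upper one. The constant in the bound for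
the inverse disappears after division by `n`. -/
lemma neg_lower_le_mul_upper [NeZero d] {γp γm : ℝ} (hp : IsUpperExponent μ γp)
    (hm : IsLowerExponent μ γm) : -γm ≤ d * γp := by
  obtain ⟨C, hC0, hC⟩ := exists_log_opNorm_inv_le d
  obtain ⟨x, hx1, hx2⟩ := (hp.and hm).exists
  have h1 : Tendsto (fun n : ℕ => C / (n : ℝ) +
      d * (1 / (n : ℝ) * Real.log (opNorm (partialProd x n)))) atTop (𝓝 (0 + d * γp)) :=
    (tendsto_const_div_atTop_nhds_zero_nat C).add (hx1.const_mul _)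
  rw [zero_add] at h1
  refine le_of_tendsto_of_tendsto' hx2.neg h1 fun n => ?_
  rw [neg_neg]
  have hn : 0 ≤ 1 / (n : ℝ) := by positivity
  calc 1 / (n : ℝ) * Real.log (opNorm (partialProd x n)⁻¹)
      ≤ 1 / (n : ℝ) * (C + d * Real.log (opNorm (partialProd x n))) :=
        mul_le_mul_of_nonneg_left (hC _) hn
    _ = _ := by ring

lemma IsUpperExponent.isLowerExponent_neg {μ : Measure SL(2, ℝ)} [IsProbabilityMeasure μ] {γ : ℝ}
    (h : IsUpperExponent μ γ) : IsLowerExponent μ (-γ) := by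
  filter_upwards [h] with x hx
  simpa only [opNorm_inv_eq_of_two] using hx.neg

/-- The entropy bound and the existence of an invariant measure in any dimension. -/
theorem exists_exponents_entropy_le [NeZero d] (h : Integrable (fun A => Real.log (opNorm A)) μ) :
    ∃ γp γm : ℝ, γm ≤ 0 ∧ 0 ≤ γp ∧ IsUpperExponent μ γp ∧ IsLowerExponent μ γm ∧
      (∀ (ν : Measure (Proj d)) [IsProbabilityMeasure ν], IsStationary μ ν →
        entropy μ ν ≤ ENNReal.ofReal (((d : ℝ) - 1) * (γp - γm))) ∧
      (γp = 0 → ∃ ν : Measure (Proj d), IsProbabilityMeasure ν ∧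
        ∀ᵐ A ∂μ, ν.map (fun ξ => A • ξ) = ν) := by
  obtain ⟨γp, hp0, hp⟩ := exists_isUpperExponent h
  obtain ⟨γm, hm0, hm⟩ := exists_isLowerExponent h
  refine ⟨γp, γm, hm0, hp0, hp, hm, fun ν _ hν => ?_, fun hγ => ?_⟩
  · have := entropy_le hν hp hm (by linarith)
    rwa [Nat.cast_sub (NeZero.one_le), Nat.cast_one] at this
  · subst hγ
    have hm1 := neg_lower_le_mul_upper hp hm
    obtain rfl : γm = 0 := le_antisymm hm0 (by linarith)
    obtain ⟨ν, hνp, hν⟩ := exists_isStationary μ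
      (Classical.arbitrary (Proj d))
    exact ⟨ν, hνp, ae_map_smul_eq hν hp hm⟩

end Exponents
end Furstenberg

theorem theorem2p2 :
    (∀ (μ : Measure SL(2, ℝ)) [IsProbabilityMeasure μ],
      Integrable (fun A : SL(2, ℝ) => Real.log (Furstenberg.opNorm A)) μ →
      ∃ γ : ℝ, 0 ≤ γ ∧ Furstenberg.IsUpperExponent μ γ ∧
        Furstenberg.IsLowerExponent μ (-γ) ∧
        (∀ (ν : Measure (Furstenberg.Proj 2)) [IsProbabilityMeasure ν],
          Furstenberg.IsStationary μ ν →
          Furstenberg.entropy μ ν ≤ ENNReal.ofReal (2 * γ)) ∧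
        (γ = 0 → ∃ ν : Measure (Furstenberg.Proj 2), IsProbabilityMeasure ν ∧
          ∀ᵐ A ∂μ, ν.map (fun ξ => A • ξ) = ν)) ∧
    (∀ (d : ℕ), 2 ≤ d → ∀ (μ : Measure SL(d, ℝ)) [IsProbabilityMeasure μ],
      Integrable (fun A : SL(d, ℝ) => Real.log (Furstenberg.opNorm A)) μ →
      ∃ γp γm : ℝ, γm ≤ 0 ∧ 0 ≤ γp ∧ Furstenberg.IsUpperExponent μ γp ∧
        Furstenberg.IsLowerExponent μ γm ∧
        (∀ (ν : Measure (Furstenberg.Proj d)) [IsProbabilityMeasure ν],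
          Furstenberg.IsStationary μ ν →
          Furstenberg.entropy μ ν ≤ ENNReal.ofReal (((d : ℝ) - 1) * (γp - γm))) ∧
        (γp = 0 → ∃ ν : Measure (Furstenberg.Proj d), IsProbabilityMeasure ν ∧
          ∀ᵐ A ∂μ, ν.map (fun ξ => A • ξ) = ν)) := by

  refine ⟨fun μ _ h => ?_, fun d hd μ _ h => ?_⟩
  · obtain ⟨γp, γm, -, hp0, hp, hm, hent, hinv⟩ := Furstenberg.exists_exponents_entropy_le h
    have hm' := hp.isLowerExponent_neg
    -- One sequence at which both limits hold identifies the lower exponent with the negative of the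
    -- upper one, and (2 - 1)(γ - (-γ)) = 2γ.
    obtain ⟨x, hx1, hx2⟩ := (hm.and hm').exists
    obtain rfl : γm = -γp := tendsto_nhds_unique hx1 hx2
    refine ⟨γp, hp0, hp, hm, fun ν _ hν => ?_, hinv⟩
    refine (hent ν hν).trans_eq (congrArg ENNReal.ofReal ?_)
    push_cast
    ring
  · have : NeZero d := ⟨by omega⟩
    exact Furstenberg.exists_exponents_entropy_le h
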